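/- **Setting.** Let $(\mathsf P,d)$ be a metric space, $\Theta\subseteq \mathsf P$, $\theta_0\in\Theta^0$ (the interior of $\Theta$), and let $\overline\Theta\subseteq\Theta$ be a compact neighbourhood of $\theta_0$. Let $\{g(\cdot;\theta):\theta\in\Theta\}$ be probability densities on $[0,\infty)$ such that 1. for almost every $x$, the condition $g(x;\theta)=0$ does not depend on $\theta\in\Theta$ (common support), and $\theta\mapsto g(x;\theta)$ is continuous on $\Theta$; 2. every $\theta\in\Theta$ has a neighbourhood $U$ in $\Theta$ and an integrable function $h$ with $g(x;\vartheta)\le h(x)$ for almost every $x$ and all $\vartheta\in U$; 3. (identifiability) if $\theta_1,\theta_2\in\overline\Theta$ and $g(\cdot;\theta_1)=g(\cdot;\theta_2)$ almost everywhere, then $\theta_1=\theta_2$. Write $g^{*(k)}$ for the $k$-fold self-convolution of $g$ (with $g^{*(0)}$ the unit mass at $0$, i.e. $g^{*(0)}(0)=1$). **Data.** Let $f$ be a probability density on $\mathbb R$ not depending on $\theta$, let $p_M(m+1)$, $m\ge 0$, be a known probability mass function with $p_M(m+1)>0$ for some $m\ge1$, and let $q\in(0,1)$. Flows $i=1,2,\dots$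 are independent and identically distributed. A flow has $M+1$ packets, where $\Pr(M=m)=p_M(m+1)$, and inter-renewal times $X_1,\dots,X_{M+1}$, where $X_1$ has density $f$ and $X_2,X_3,\dots$ have density $g(\cdot;\theta_0)$; given the flow size all these times are independent. Its NetFlow symbol is $S=(S_f,S_d,M+1)$ with $S_f=X_1$ and $S_d=\sum_{k=2}^{M+1}X_k$. Independently of everything else, each packet is retained with probability $q$. The sampled NetFlow is $\widetilde S=(\widetilde S_f,\widetilde S_d,\widetilde M)$, where $\widetilde M$ is the number of retained packets, $\widetilde S_f$ is the arrival time of the first retained packet, and $\widetilde S_d$ is the time between the first and the last retained packets. **Likelihoods.** For $s=(s_f,s_d,m+1)$ put $$\mathcal L_S(s;\theta)=f(s_f)\,g^{*(m)}(s_d;\theta)\,p_M(m+1).$$ With $\tau_m(\widetilde m;q)=\binom{m+1}{\widetilde m}q^{\widetilde m}(1-q)^{m+1-\widetilde m}$ and $\upsilon_{m,k}(\widetilde m)=(m+1-k)\binom{k-1}{\widetilde m-2}/\binom{m+1}{\widetilde m}$, put, for $\widetilde m\ge 2$, $$\mathcal L_{\widetilde S}(\widetilde s;\theta)=\sum_{m+1\ge\widetilde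 m}\ \sum_{k=\widetilde m-1}^{m}p_M(m+1)\,\tau_m(\widetilde m;q)\,\upsilon_{m,k}(\widetilde m)\,g^{*(k)}(\widetilde s_d;\theta),$$ and for $\widetilde m\le 1$ (no sampled duration) $\mathcal L_{\widetilde S}(\widetilde s;\theta)=\Pr(\widetilde M=\widetilde m)$, which does not involve $\theta$. The NetFlow maximum likelihood estimators $\hat\theta_S=\hat\theta_{S,n}$ and $\hat\theta_{\widetilde S}=\hat\theta_{\widetilde S,n}$ are any $\overline\Theta$-valued maximisers over $\overline\Theta$ (almost surely, for each $n$) of $$\ell_n(\theta)=\frac1n\sum_{i=1}^n\log\mathcal L_S(S_i;\theta)\qquad\text{and}\qquad\widetilde\ell_n(\theta)=\frac1n\sum_{i=1}^n\log\mathcal L_{\widetilde S}(\widetilde S_i;\theta).$$ **Unbounded flow sizes.** If $p_M(m+1)>0$ for arbitrarily large $m$, assume in addition that $\sum_m m\,p_M(m+1)<\infty$, that $\int_0^\infty\log(1+x)\,g(x;\theta_0)\,dx<\infty$, and that the series $$\xi(\widetilde m,x;\theta)=\sum_{k=1}^\infty\Big(\sum_{m\ge k}p_M(m+1)\,\tau_m(\widetilde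 m;q)\,\upsilon_{m,k}(\widetilde m)\Big)g^{*(k)}(x;\theta)$$ converges uniformly, jointly in $\widetilde m\ge2$, $x>0$ and $\theta\in\overline\Theta$. **Proposition.** Both NetFlow maximum likelihood estimators are consistent: as $n\to\infty$, $\hat\theta_{S,n}\to\theta_0$ in probability and $\hat\theta_{\widetilde S,n}\to\theta_0$ in probability. -/

import Mathlib

open MeasureTheory ProbabilityTheory Filter Topology
open scoped ENNReal

namespace NetFlow

noncomputable section

/-! ### Flows and their NetFlow summaries

A flow with `m + 1` packets is given by its inter-renewal times `x 0, …, x m`; `x 0` separates the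
flow from the preceding one, and packet `j` (for `0 ≤ j ≤ m`) arrives at time `x 0 + ⋯ + x j`. -/

/-- The NetFlow symbol `(s_f, s_d, m + 1)` of a flow: first inter-renewal time, flow duration
(which is `0` if `m = 0`), flow size. -/
def symbol (x : ℕ → ℝ) (m : ℕ) : ℝ × ℝ × ℕ :=
  (x 0, ∑ j ∈ Finset.Icc 1 m, x j, m + 1)

/-- The packets of a flow of size `m + 1` which are retained under the thinning marks `b`. -/
def retained (b : ℕ → Bool) (m : ℕ) : Finset ℕ :=
  (Finset.range (m + 1)).filter (fun j => b j = true)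

/-- The sampled NetFlow symbol `(s_f, s_d, m̃)` of a flow whose set of retained packets is `R`:
the arrival time of the first retained packet, the time between the first and the last retained
packets, and the number of retained packets (`(0, 0, 0)` if nothing is retained). -/
def sampledSymbol (x : ℕ → ℝ) (R : Finset ℕ) : ℝ × ℝ × ℕ :=
  if h : R.Nonempty then
    (∑ j ∈ Finset.range (R.min' h + 1), x j, ∑ j ∈ Finset.Ioc (R.min' h) (R.max' h), x j, R.card)
  else (0, 0, 0)

/-! ### Likelihoods

`p m` stands for `p_M(m + 1)`, the probability that a flow has `m + 1` packets, and `g` for the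
inter-renewal density at a given parameter. -/

/-- The `k`-fold self-convolution `g^{*(k)}` of a density `g` on the real line. The `0`-fold one is
the density of the unit mass at `0` with respect to itself. -/
def selfConv (g : ℝ → ℝ≥0∞) : ℕ → ℝ → ℝ≥0∞
  | 0 => fun x => if x = 0 then 1 else 0
  | 1 => g
  | k + 2 => lconvolution (selfConv g (k + 1)) g volume

/-- The NetFlow likelihood `f(s_f) g^{*(m)}(s_d) p_M(m + 1)` of a symbol `s = (s_f, s_d, m + 1)`. -/
def likelihood (f : ℝ → ℝ≥0∞) (p : PMF ℕ) (g : ℝ → ℝ≥0∞) (s : ℝ × ℝ × ℕ) : ℝ≥0∞ :=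
  f s.1 * selfConv g (s.2.2 - 1) s.2.1 * p (s.2.2 - 1)

/-- `τ_m(m̃; q)`: the probability that `r` of the `m + 1` packets of a flow are retained. -/
def tau (q : ℝ) (m r : ℕ) : ℝ :=
  ((m + 1).choose r : ℝ) * q ^ r * (1 - q) ^ (m + 1 - r)

/-- `υ_{m,k}(m̃)`, for `m̃ ≥ 2` and `1 ≤ k ≤ m`: the probability that there are `k` inter-renewals
between the first and the last of `r` retained packets, given that `r` of `m + 1` are retained. -/
def upsilon (m k r : ℕ) : ℝ :=
  ((m : ℝ) + 1 - k) * ((k - 1).choose (r - 2) : ℝ) / ((m + 1).choose r : ℝ)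

/-- The restricted sub-sampled NetFlow likelihood of a sampled symbol `s = (s_f, s_d, m̃)`, in which
the first component is not used. A flow with at most one retained packet has no sampled duration:
its likelihood is the probability of retaining `m̃` packets, which does not involve `g`. -/
def sampledLikelihood (p : PMF ℕ) (q : ℝ) (g : ℝ → ℝ≥0∞) (s : ℝ × ℝ × ℕ) : ℝ≥0∞ :=
  if s.2.2 < 2 then ∑' m : ℕ, p m * ENNReal.ofReal (tau q m s.2.2)
  else ∑' m : ℕ, ∑ k ∈ Finset.Icc (s.2.2 - 1) m,
    p m * ENNReal.ofReal (tau q m s.2.2 * upsilon m k s.2.2) * selfConv g k s.2.1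

/-- The coefficient of `g^{*(k)}` in the sub-sampled likelihood for `r ≥ 2` retained packets. -/
def xiCoeff (p : PMF ℕ) (q : ℝ) (r k : ℕ) : ℝ≥0∞ :=
  ∑' m : ℕ, if k ≤ m then p m * ENNReal.ofReal (tau q m r * upsilon m k r) else 0

/-- The partial sum over `1 ≤ k ≤ N` of the series `ξ` of weighted self-convolutions. -/
def xiPartial (p : PMF ℕ) (q : ℝ) (g : ℝ → ℝ≥0∞) (r N : ℕ) (x : ℝ) : ℝ≥0∞ :=
  ∑ k ∈ Finset.Icc 1 N, xiCoeff p q r k * selfConv g k x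

/-- The series `ξ = ∑_{k ≥ 1} xiCoeff k * g^{*(k)}`. -/
def xi (p : PMF ℕ) (q : ℝ) (g : ℝ → ℝ≥0∞) (r : ℕ) (x : ℝ) : ℝ≥0∞ :=
  ∑' k : ℕ, xiCoeff p q r (k + 1) * selfConv g (k + 1) x

/-- `ξ` converges jointly uniformly over the sampled symbols `(r, x)`, `r ≥ 2`, `x > 0`, and the
parameters in `K`. -/
def XiConvergesUniformly {P : Type*} (p : PMF ℕ) (q : ℝ) (g : P → ℝ → ℝ≥0∞) (K : Set P) : Prop :=
  TendstoUniformlyOn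
    (fun (N : ℕ) (z : ℕ × ℝ × P) => (xiPartial p q (g z.2.2) z.1 N z.2.1).toReal)
    (fun z : ℕ × ℝ × P => (xi p q (g z.2.2) z.1 z.2.1).toReal)
    atTop {z | 2 ≤ z.1 ∧ 0 < z.2.1 ∧ z.2.2 ∈ K}

/-- The average log-likelihood `n⁻¹ ∑_{i < n} log L(s_i)` of the first `n` symbols. -/
def avgLogLik (L : ℝ × ℝ × ℕ → ℝ≥0∞) (s : ℕ → ℝ × ℝ × ℕ) (n : ℕ) : ℝ :=
  (n : ℝ)⁻¹ * ∑ i ∈ Finset.range n, Real.log (L (s i)).toReal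

/-! ### Assumptions on the model -/

/-- Regularity of the inter-renewal model `g θ`, `θ ∈ Θ`. -/
structure IsRegular {P : Type*} [TopologicalSpace P] (g : P → ℝ → ℝ≥0∞) (Θ : Set P) : Prop where
  measurable : ∀ θ ∈ Θ, Measurable (g θ)
  lintegral_eq_one : ∀ θ ∈ Θ, ∫⁻ x, g θ x = 1
  /-- inter-renewal times are nonnegative -/
  eq_zero_of_neg : ∀ θ ∈ Θ, ∀ x < 0, g θ x = 0
  /-- the distributions have common support -/
  common_support : ∀ᵐ x : ℝ, ∀ θ ∈ Θ, ∀ θ' ∈ Θ, g θ x = 0 ↔ g θ' x = 0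
  /-- the density is continuous in the parameter -/
  continuousOn : ∀ᵐ x : ℝ, ContinuousOn (fun θ => g θ x) Θ
  /-- near each parameter the densities have a common integrable bound -/
  locally_dominated : ∀ θ ∈ Θ, ∃ U ∈ 𝓝[Θ] θ, ∃ h : ℝ → ℝ≥0∞, Measurable h ∧ ∫⁻ x, h x ≠ ∞ ∧
    ∀ᵐ x : ℝ, ∀ ϑ ∈ U, g ϑ x ≤ h x

/-- `g θ`, `θ ∈ K`, is identifiable: different parameters give different distributions. -/
def Identifiable {P : Type*} (g : P → ℝ → ℝ≥0∞) (K : Set P) : Prop :=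
  ∀ θ₁ ∈ K, ∀ θ₂ ∈ K, g θ₁ =ᵐ[volume] g θ₂ → θ₁ = θ₂

/-- A session of independent flows of a Bartlett--Lewis (delayed finite renewal) process with
Bernoulli marks. Flow `i` has `M i + 1` packets, inter-renewal times `X i 0, …, X i (M i)`, and
its packet `j` is retained if `B i j = true`. The first inter-renewal time of a flow has density
`f`, the others have density `g₀`, and each packet is retained with probability `q`. (It is
convenient to let the variables `X i j`, `B i j` with `j > M i` exist; they are not used.) -/
structure IsSession {Ω : Type*} [MeasurableSpace Ω] (μ : Measure Ω) (f g₀ : ℝ → ℝ≥0∞) (p : PMF ℕ)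
    (q : ℝ) (M : ℕ → Ω → ℕ) (X : ℕ → ℕ → Ω → ℝ) (B : ℕ → ℕ → Ω → Bool) : Prop where
  measurable_size : ∀ i, Measurable (M i)
  measurable_time : ∀ i j, Measurable (X i j)
  measurable_mark : ∀ i j, Measurable (B i j)
  law_size : ∀ i, HasLaw (M i) p.toMeasure μ
  law_first : ∀ i, HasLaw (X i 0) (volume.withDensity f) μ
  law_time : ∀ i j, 1 ≤ j → HasLaw (X i j) (volume.withDensity g₀) μ
  law_mark : ∀ i j, μ {ω | B i j ω = true} = ENNReal.ofReal q
  /-- the flows are independent -/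
  indep_flow : iIndepFun (fun i ω => (M i ω, (fun j => X i j ω), (fun j => B i j ω))) μ
  /-- within a flow, sizes, inter-renewal times and marks are independent -/
  indep_size : ∀ i, IndepFun (M i) (fun ω => ((fun j => X i j ω), (fun j => B i j ω))) μ
  indep_time_mark : ∀ i, IndepFun (fun ω j => X i j ω) (fun ω j => B i j ω) μ
  indep_time : ∀ i, iIndepFun (X i) μ
  indep_mark : ∀ i, iIndepFun (B i) μ

/-- `θhat n`, `n = 0, 1, …`, are maximum likelihood estimators over `K`: almost surely, `θhat n`
maximises over `K` the average log-likelihood of the first `n` of the symbols `s`. -/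
def IsMLE {Ω P : Type*} [MeasurableSpace Ω] (μ : Measure Ω) (L : P → ℝ × ℝ × ℕ → ℝ≥0∞)
    (s : ℕ → Ω → ℝ × ℝ × ℕ) (K : Set P) (θhat : ℕ → Ω → P) : Prop :=
  ∀ n, ∀ᵐ ω ∂μ, θhat n ω ∈ K ∧
    IsMaxOn (fun θ => avgLogLik (L θ) (fun i => s i ω) n) K (θhat n ω)

end

end NetFlow

namespace NetFlow

/-! The proof is Wald's consistency argument. Let `Y θ = L θ / L θ₀` be the likelihood ratio, viewed
under the true law. An estimator far from `θ₀` would need `∑ log Y ≥ 0` at some distant parameter.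
Since `log Y` may have no lower integrable bound, it is replaced by `log (1 + Y)`, which is
nonnegative: `4 y ≤ (1 + y) ^ 2` gives `log Y ≤ 2 (log (1 + Y) - log 2)`, and `E Y ≤ 1` gives `E log
(1 + Y) < log 2` unless `Y = 1` almost surely. Continuity, compactness and the law of large numbers
finish the argument (`tendstoInMeasure_of_likelihood_ratio`). It remains to supply densities,
identifiability and an integrable bound on `log (1 + Y)`, uniform in `θ`.

Densities: only duration and packet count matter, since `f` cancels from the ratio and the sampled
likelihood ignores the first component. On `ℝ × ℕ` the laws of the two summaries have the
likelihoods as densities with respect to explicit layered measures (`map_symbol`,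
`map_sampledSymbol`). In the sampled case this rests on counting the retained sets with given size
and given distance between extremes.

Identifiability: the Laplace transform of `g^{*(k)}` is the `k`-th power of that of `g`, and the
transform of `ξ` is a power series in it with nonnegative coefficients, not all zero, hence strictly
increasing. So the likelihood determines the Laplace transform at all integers, and thereby `g`
(`ae_eq_of_laplace_eq`).

Domination: on the compact set all densities lie below one integrable `h` of mass `C ≥ 1`. Without
sampling, scaling the ratio by `C ^ m` leaves a term linear in `m`, integrable by the mean flow
size. With sampling, uniform convergence yields `ξ ≤ ξ_N + 1` for one fixed `N`; the partial sum is
dominated by its analogue for `h`, and the extra `1`, not integrable over all durations and counts,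
is traded for an integrable weight at the cost of a logarithm, which the moment assumptions control.
For bounded flow sizes the series is a finite sum and the trade is not needed. -/

/-! ### Self-convolutions and their Laplace transforms -/

theorem selfConv_succ_apply (g : ℝ → ℝ≥0∞) (k : ℕ) (x : ℝ) :
    selfConv g (k + 2) x = ∫⁻ y, selfConv g (k + 1) y * g (-y + x) := rfl

theorem measurable_selfConv {g : ℝ → ℝ≥0∞} (hg : Measurable g) (k : ℕ) :
    Measurable (selfConv g k) := by
  match k with
  | 0 => exact Measurable.ite (measurableSet_singleton 0) measurable_const measurable_const
  | 1 => exact hg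
  | k + 2 => exact measurable_lconvolution _ (measurable_selfConv hg (k + 1)) hg

/-- Tonelli and translation invariance make the transform multiplicative. The index starts at `k +
1` because `selfConv g 0` is a density with respect to the Dirac mass, not Lebesgue measure. The
case `t = 0` gives the total masses. -/
theorem lintegral_exp_mul_selfConv {g : ℝ → ℝ≥0∞} (hg : Measurable g) (t : ℝ) (k : ℕ) :
    ∫⁻ x, ENNReal.ofReal (Real.exp (-t * x)) * selfConv g (k + 1) x
      = (∫⁻ x, ENNReal.ofReal (Real.exp (-t * x)) * g x) ^ (k + 1) := by
  induction k with
  | zero => simp [selfConv]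
  | succ k ih =>
    have hm := measurable_selfConv hg (k + 1)
    calc ∫⁻ x, ENNReal.ofReal (Real.exp (-t * x)) * selfConv g (k + 1 + 1) x
        = ∫⁻ x, ∫⁻ y, ENNReal.ofReal (Real.exp (-t * x)) *
            (selfConv g (k + 1) y * g (-y + x)) := by
          refine lintegral_congr fun x => ?_
          rw [selfConv_succ_apply, lintegral_const_mul _ (by fun_prop)]
      _ = ∫⁻ y, ∫⁻ x, ENNReal.ofReal (Real.exp (-t * x)) *
            (selfConv g (k + 1) y * g (-y + x)) :=
          lintegral_lintegral_swap (by fun_prop)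
      _ = ∫⁻ y, ENNReal.ofReal (Real.exp (-t * y)) * selfConv g (k + 1) y *
            ∫⁻ x, ENNReal.ofReal (Real.exp (-t * x)) * g x := by
          refine lintegral_congr fun y => ?_
          rw [← lintegral_const_mul _ (by fun_prop), ← lintegral_add_left_eq_self _ y]
          refine lintegral_congr fun x => ?_
          rw [neg_add_cancel_left, mul_add, Real.exp_add, ENNReal.ofReal_mul (Real.exp_nonneg _)]
          ring
      _ = _ := by
          rw [lintegral_mul_const _ (by fun_prop), ih, ← pow_succ]

theorem lintegral_selfConv {g : ℝ → ℝ≥0∞} (hg : Measurable g) (k : ℕ) :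
    ∫⁻ x, selfConv g (k + 1) x = (∫⁻ x, g x) ^ (k + 1) := by
  simpa using lintegral_exp_mul_selfConv hg 0 k

theorem ae_sub_of_ae {s : ℝ → Prop} (hs : ∀ᵐ x : ℝ, s x) (x : ℝ) : ∀ᵐ y : ℝ, s (-y + x) := by
  have h : Measure.QuasiMeasurePreserving (fun y : ℝ => x - y) volume volume :=
    (Measure.measurePreserving_sub_left volume x).quasiMeasurePreserving
  filter_upwards [h.ae hs] with y hy
  rwa [neg_add_eq_sub]

theorem selfConv_eq_zero_of_neg {g : ℝ → ℝ≥0∞} (hg : ∀ x < 0, g x = 0) (k : ℕ) :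
    ∀ x < 0, selfConv g k x = 0 := by
  match k with
  | 0 => intro x hx; simp [selfConv, hx.ne]
  | 1 => exact hg
  | k + 2 =>
    intro x hx
    rw [selfConv_succ_apply]
    refine (lintegral_congr fun y => ?_).trans lintegral_zero
    rcases lt_or_ge y 0 with hy | hy
    · rw [selfConv_eq_zero_of_neg hg (k + 1) y hy, zero_mul]
    · rw [hg _ (by linarith), mul_zero]

/-- The reference measure of the `k`-fold self-convolution. -/
noncomputable def convBase (k : ℕ) : Measure ℝ := if k = 0 then Measure.dirac 0 else volume

instance (k : ℕ) : SigmaFinite (convBase k) := by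
  unfold convBase; split_ifs <;> infer_instance

/-! ### Families of densities -/

section Family

variable {P : Type*} {g : P → ℝ → ℝ≥0∞} {K : Set P}

/-- From `k = 2` on the bound holds at every point, because the convolution integral ignores null
sets. One exceptional set thus serves all parameters at once, as the suprema over `θ` require. -/
theorem ae_selfConv_le {h : ℝ → ℝ≥0∞} (hgh : ∀ᵐ x : ℝ, ∀ θ ∈ K, g θ x ≤ h x) (k : ℕ) :
    ∀ᵐ x ∂(convBase k), ∀ θ ∈ K, selfConv (g θ) k x ≤ selfConv h k x := by
  match k with
  | 0 => exact .of_forall fun x θ _ => le_rfl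
  | 1 => exact hgh
  | k + 2 =>
    refine .of_forall fun x θ hθ => ?_
    refine lintegral_mono_ae ?_
    have := ae_selfConv_le hgh (k + 1)
    simp only [convBase, Nat.add_eq_zero_iff, one_ne_zero, and_false, if_false] at this
    filter_upwards [this, ae_sub_of_ae hgh x] with y h1 h2
    exact mul_le_mul' (h1 θ hθ) (h2 θ hθ)

/-- A convolution of nonnegative functions vanishes at `x` exactly when its integrand vanishes
almost everywhere, which depends only on the zero sets of the factors. -/
theorem ae_selfConv_eq_zero_iff (hm : ∀ θ ∈ K, Measurable (g θ))
    (h0 : ∀ᵐ x : ℝ, ∀ θ ∈ K, ∀ θ' ∈ K, g θ x = 0 ↔ g θ' x = 0) (k : ℕ) :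
    ∀ᵐ x ∂(convBase k), ∀ θ ∈ K, ∀ θ' ∈ K, selfConv (g θ) k x = 0 ↔ selfConv (g θ') k x = 0 := by
  match k with
  | 0 => exact .of_forall fun x θ _ _ _ => Iff.rfl
  | 1 => exact h0
  | k + 2 =>
    refine .of_forall fun x θ hθ θ' hθ' => ?_
    have hms : ∀ θ ∈ K, Measurable fun y => selfConv (g θ) (k + 1) y * g θ (-y + x) := by
      intro θ hθ
      have := measurable_selfConv (hm θ hθ) (k + 1)
      have := hm θ hθ
      fun_prop
    rw [selfConv_succ_apply, selfConv_succ_apply, lintegral_eq_zero_iff (hms θ hθ),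
      lintegral_eq_zero_iff (hms θ' hθ')]
    have := ae_selfConv_eq_zero_iff hm h0 (k + 1)
    simp only [convBase, Nat.add_eq_zero_iff, one_ne_zero, and_false, if_false] at this
    refine eventually_congr ?_
    filter_upwards [this, ae_sub_of_ae h0 x] with y h1 h2
    simp [h1 θ hθ θ' hθ', h2 θ hθ θ' hθ']

theorem ae_selfConv_lt_top {h : ℝ → ℝ≥0∞} (hm : Measurable h) (hi : ∫⁻ x, h x ≠ ∞) (k : ℕ) :
    ∀ᵐ x ∂(convBase k), selfConv h k x < ∞ := by
  match k with
  | 0 => exact .of_forall fun x => by simp only [selfConv]; split_ifs <;> simp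
  | k + 1 =>
    refine ae_lt_top (measurable_selfConv hm _) ?_
    simp only [convBase, Nat.add_eq_zero_iff, one_ne_zero, and_false, if_false]
    rw [lintegral_selfConv hm]
    exact ENNReal.pow_ne_top hi

theorem ae_continuousOn_selfConv [PseudoMetricSpace P] (hm : ∀ θ ∈ K, Measurable (g θ))
    {h : ℝ → ℝ≥0∞} (hh : Measurable h) (hi : ∫⁻ x, h x ≠ ∞)
    (hgh : ∀ᵐ x : ℝ, ∀ θ ∈ K, g θ x ≤ h x)
    (hc : ∀ᵐ x : ℝ, ContinuousOn (fun θ => g θ x) K) (k : ℕ) :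
    ∀ᵐ x ∂(convBase k), ContinuousOn (fun θ => selfConv (g θ) k x) K := by
  match k with
  | 0 => exact .of_forall fun x => continuousOn_const
  | 1 => exact hc
  | k + 2 =>
    have hle := ae_selfConv_le hgh (k + 1)
    have hco := ae_continuousOn_selfConv hm hh hi hgh hc (k + 1)
    have hlt := ae_selfConv_lt_top hh hi (k + 1)
    have hlt1 := ae_selfConv_lt_top hh hi 1
    have hlt2 := ae_selfConv_lt_top hh hi (k + 2)
    simp only [convBase, Nat.add_eq_zero_iff, one_ne_zero, OfNat.ofNat_ne_zero,
      and_false, if_false] at hle hco hlt hlt1 hlt2 ⊢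
    filter_upwards [hlt2] with x hx θ hθ
    -- The dominating integrand has integral `selfConv h (k + 2) x`, finite for almost every `x`.
    refine tendsto_lintegral_filter_of_dominated_convergence
      (fun y => selfConv h (k + 1) y * h (-y + x)) ?_ ?_ hx.ne ?_
    · filter_upwards [self_mem_nhdsWithin] with ϑ hϑ
      have := measurable_selfConv (hm ϑ hϑ) (k + 1)
      have := hm ϑ hϑ
      fun_prop
    · filter_upwards [self_mem_nhdsWithin] with ϑ hϑ
      filter_upwards [hle, ae_sub_of_ae hgh x] with y h1 h2
      exact mul_le_mul' (h1 ϑ hϑ) (h2 ϑ hϑ)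
    · filter_upwards [hle, ae_sub_of_ae hgh x, hco, ae_sub_of_ae hc x, hlt, ae_sub_of_ae hlt1 x]
        with y h1 h2 h3 h4 h5 h6
      exact ENNReal.Tendsto.mul (h3 θ hθ) (.inr ((h2 θ hθ).trans_lt h6).ne) (h4 θ hθ)
        (.inr ((h1 θ hθ).trans_lt h5).ne)

end Family

/-! ### Determination of a density by its Laplace transform at the integers -/

open BoundedContinuousFunction

/-- Finite measures on the unit interval are determined by their moments. -/
theorem ext_of_moments {μ ν : Measure unitInterval} [IsFiniteMeasure μ] [IsFiniteMeasure ν]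
    (h : ∀ n : ℕ, ∫ x, (x : ℝ) ^ n ∂μ = ∫ x, (x : ℝ) ^ n ∂ν) : μ = ν := by
  -- Stone–Weierstrass: polynomial functions separate points, so equality of their integrals
  -- suffices.
  let A : StarSubalgebra ℝ (unitInterval →ᵇ ℝ) :=
    { carrier := {f | ∃ p : Polynomial ℝ, ∀ x, f x = p.eval (x : ℝ)}
      mul_mem' := by
        rintro f f' ⟨p, hp⟩ ⟨p', hp'⟩
        exact ⟨p * p', fun x => by simp [hp, hp']⟩
      add_mem' := by
        rintro f f' ⟨p, hp⟩ ⟨p', hp'⟩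
        exact ⟨p + p', fun x => by simp [hp, hp']⟩
      algebraMap_mem' := fun r => ⟨Polynomial.C r, fun x => by simp⟩
      star_mem' := by
        rintro f ⟨p, hp⟩
        exact ⟨p, fun x => by simp [hp]⟩ }
  refine ext_of_forall_mem_subalgebra_integral_eq_of_pseudoEMetric_complete_countable
    (𝕜 := ℝ) (A := A) ?_ ?_
  · intro x y hxy
    let F : unitInterval →ᵇ ℝ := mkOfCompact ⟨fun x => (x : ℝ), continuous_subtype_val⟩
    refine ⟨_, ⟨toContinuousMapStarₐ ℝ F, ⟨F, ⟨Polynomial.X, fun x => by simp [F]⟩, rfl⟩, rfl⟩, ?_⟩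
    simpa [F] using fun h => hxy (Subtype.ext h)
  · rintro f ⟨p, hp⟩
    have hint : ∀ (κ : Measure unitInterval) [IsFiniteMeasure κ] (n : ℕ),
        Integrable (fun x : unitInterval => p.coeff n * (x : ℝ) ^ n) κ := by
      intro κ _ n
      refine Integrable.const_mul ?_ _
      refine Integrable.of_bound (by fun_prop) 1 (.of_forall fun x => ?_)
      rw [Real.norm_of_nonneg (pow_nonneg x.2.1 n)]
      exact pow_le_one₀ x.2.1 x.2.2
    simp only [hp, Polynomial.eval_eq_sum_range]
    rw [integral_finsetSum _ fun n _ => hint μ n, integral_finsetSum _ fun n _ => hint ν n]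
    simp only [integral_const_mul, h]

/-- Densities on the half-line are determined by their Laplace transforms on the integers. -/
theorem ae_eq_of_laplace_eq {g₁ g₂ : ℝ → ℝ≥0∞} (hm₁ : Measurable g₁) (hm₂ : Measurable g₂)
    (hi₁ : ∫⁻ x, g₁ x ≠ ∞) (hi₂ : ∫⁻ x, g₂ x ≠ ∞)
    (hn₁ : ∀ x < 0, g₁ x = 0) (hn₂ : ∀ x < 0, g₂ x = 0)
    (h : ∀ n : ℕ, ∫⁻ x, ENNReal.ofReal (Real.exp (-(n : ℝ) * x)) * g₁ x
      = ∫⁻ x, ENNReal.ofReal (Real.exp (-(n : ℝ) * x)) * g₂ x) : g₁ =ᵐ[volume] g₂ := by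
  -- The substitution `e^{-x}` turns Laplace transforms at integers into moments on the unit
  -- interval. The projection only alters negative `x`, where the densities vanish, and `ψ` below
  -- inverts `φ` on the half-line.
  let φ : ℝ → unitInterval := fun x => Set.projIcc 0 1 zero_le_one (Real.exp (-x))
  have hφ : Measurable φ := (continuous_projIcc.comp (by fun_prop)).measurable
  have hφv : ∀ x, 0 ≤ x → (φ x : ℝ) = Real.exp (-x) := fun x hx => by
    simp only [φ]
    rw [Set.projIcc_of_mem _ ⟨Real.exp_nonneg _, by simpa using hx⟩]
  let ψ : unitInterval → ℝ := fun y => -Real.log y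
  have hψ : Measurable ψ := by fun_prop
  have key : ∀ g : ℝ → ℝ≥0∞, Measurable g → (∀ x < 0, g x = 0) →
      (∀ᵐ x ∂(volume.withDensity g), 0 ≤ x) := fun g hm hn => by
    rw [ae_withDensity_iff hm]
    exact .of_forall fun x hx => not_lt.1 fun h => hx (hn x h)
  have hmom : ∀ g : ℝ → ℝ≥0∞, Measurable g → (∀ x < 0, g x = 0) → ∀ n : ℕ,
      ∫ y, (y : ℝ) ^ n ∂((volume.withDensity g).map φ)
        = (∫⁻ x, ENNReal.ofReal (Real.exp (-(n : ℝ) * x)) * g x).toReal := by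
    intro g hm hn n
    rw [integral_map hφ.aemeasurable (by fun_prop), integral_eq_lintegral_of_nonneg_ae
      (.of_forall fun x => pow_nonneg (φ x).2.1 n) (by fun_prop)]
    congr 1
    rw [lintegral_withDensity_eq_lintegral_mul _ hm (by fun_prop)]
    refine lintegral_congr fun x => ?_
    rcases lt_or_ge x 0 with hx | hx
    · simp [hn x hx]
    · simp only [Pi.mul_apply, hφv x hx]
      rw [mul_comm, ← Real.exp_nat_mul]
      congr 3; ring
  have hfin₁ := isFiniteMeasure_withDensity hi₁
  have hfin₂ := isFiniteMeasure_withDensity hi₂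
  have hmap : (volume.withDensity g₁).map φ = (volume.withDensity g₂).map φ :=
    ext_of_moments fun n => by rw [hmom g₁ hm₁ hn₁, hmom g₂ hm₂ hn₂, h n]
  have hback : ∀ g : ℝ → ℝ≥0∞, Measurable g → (∀ x < 0, g x = 0) →
      ((volume.withDensity g).map φ).map ψ = volume.withDensity g := by
    intro g hm hn
    rw [Measure.map_map hψ hφ]
    conv_rhs => rw [← Measure.map_id (μ := volume.withDensity g)]
    refine Measure.map_congr ?_
    filter_upwards [key g hm hn] with x hx
    simp [ψ, hφv x hx]
  have := (hback g₁ hm₁ hn₁).symm.trans ((congrArg _ hmap).trans (hback g₂ hm₂ hn₂))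
  exact (withDensity_eq_iff hm₁.aemeasurable hm₂.aemeasurable hi₁).1 this

/-! ### Logarithmic inequalities and Wald's argument -/

/-- The right-hand side is the tangent line of `log (1 + y)` at `y = 1`, so its expectation is at
most `log 2` when the mean of `y` is at most `1`. -/
theorem log_one_add_le_of_pos {y : ℝ} (hy : 0 < y) :
    Real.log (1 + y) ≤ Real.log 2 + (y - 1) / 2 := by
  have h := Real.log_le_sub_one_of_pos (x := (1 + y) / 2) (by linarith)
  rw [Real.log_div (by linarith) two_ne_zero] at h
  linarith

theorem eq_one_of_log_one_add_eq {y : ℝ} (hy : 0 < y)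
    (h : Real.log (1 + y) = Real.log 2 + (y - 1) / 2) : y = 1 := by
  by_contra hne
  have h' := Real.log_lt_sub_one_of_pos (x := (1 + y) / 2) (by linarith) (fun h => hne (by linarith))
  rw [Real.log_div (by linarith) two_ne_zero] at h'
  linarith

theorem log_le_two_mul_log_one_add {y : ℝ} (hy : 0 < y) :
    Real.log y ≤ 2 * (Real.log (1 + y) - Real.log 2) := by
  have h : Real.log (4 * y) ≤ Real.log ((1 + y) ^ 2) :=
    Real.log_le_log (by linarith) (by nlinarith [sq_nonneg (y - 1)])
  rw [Real.log_mul (by norm_num) hy.ne', Real.log_pow, show (4 : ℝ) = 2 ^ 2 by norm_num,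
    Real.log_pow] at h
  push_cast at h
  linarith

section Wald

variable {E : Type*} [MeasurableSpace E] {ν : Measure E}

/-- A form of the information inequality for `log (1 + y)`. -/
theorem lintegral_log_one_add_lt [IsProbabilityMeasure ν] {Y : E → ℝ} (hY : Measurable Y) (hpos : ∀ᵐ e ∂ν, 0 < Y e)
    (hle : ∫⁻ e, ENNReal.ofReal (Y e) ∂ν ≤ 1) (hne : ¬ Y =ᵐ[ν] fun _ => 1) :
    ∫⁻ e, ENNReal.ofReal (Real.log (1 + Y e)) ∂ν < ENNReal.ofReal (Real.log 2) := by
  have hYi : Integrable Y ν := by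
    refine ⟨hY.aestronglyMeasurable, ?_⟩
    rw [hasFiniteIntegral_iff_ofReal (hpos.mono fun e h => h.le)]
    exact hle.trans_lt ENNReal.one_lt_top
  have hY1 : ∫ e, Y e ∂ν ≤ 1 := by
    rw [integral_eq_lintegral_of_nonneg_ae (hpos.mono fun e h => h.le) hY.aestronglyMeasurable]
    exact ENNReal.toReal_le_of_le_ofReal zero_le_one (by simpa using hle)
  have hlog0 : ∀ᵐ e ∂ν, 0 ≤ Real.log (1 + Y e) :=
    hpos.mono fun e h => Real.log_nonneg (by linarith)
  have hLi : Integrable (fun e => Real.log (1 + Y e)) ν := by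
    refine hYi.mono' (hY.const_add 1).log.aestronglyMeasurable ?_
    filter_upwards [hpos, hlog0] with e h h0
    rw [Real.norm_of_nonneg h0]
    linarith [Real.log_le_sub_one_of_pos (x := 1 + Y e) (by linarith)]
  rw [← ofReal_integral_eq_lintegral_ofReal hLi hlog0,
    ENNReal.ofReal_lt_ofReal_iff (Real.log_pos one_lt_two)]
  -- If the strict inequality failed, the nonnegative gap between the tangent line and `log (1 + Y)`
  -- would have integral zero, so it would vanish almost everywhere and strict concavity would force
  -- `Y = 1`.
  by_contra! hcon
  have hφi : Integrable (fun e => Real.log 2 + (Y e - 1) / 2) ν :=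
    (integrable_const _).add ((hYi.sub (integrable_const _)).div_const 2)
  have hφ : ∫ e, (Real.log 2 + (Y e - 1) / 2) ∂ν ≤ Real.log 2 := by
    have h1 : Integrable (fun e => Y e - 1) ν := hYi.sub (integrable_const _)
    rw [integral_add (integrable_const _) (h1.div_const 2),
      integral_div, integral_sub hYi (integrable_const _)]
    simp only [integral_const, probReal_univ, smul_eq_mul, one_mul]
    linarith
  have hae : (fun e => Real.log 2 + (Y e - 1) / 2) - (fun e => Real.log (1 + Y e)) =ᵐ[ν] 0 := by
    have hnn : 0 ≤ᵐ[ν] (fun e => Real.log 2 + (Y e - 1) / 2) - (fun e => Real.log (1 + Y e)) :=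
      hpos.mono fun e h => sub_nonneg.2 (log_one_add_le_of_pos h)
    refine (integral_eq_zero_iff_of_nonneg_ae hnn (hφi.sub hLi)).1 (le_antisymm ?_
      (integral_nonneg_of_ae hnn))
    rw [integral_sub' hφi hLi]
    linarith
  refine hne ?_
  filter_upwards [hae, hpos] with e h hp
  exact eq_one_of_log_one_add_eq hp (sub_eq_zero.1 h).symm

/-- The local bound in Wald's consistency argument: near a parameter with log-likelihood ratio of
negative mean, the log-likelihood ratios are dominated by a function of negative mean. -/
theorem exists_local_bound {P : Type*} [PseudoMetricSpace P] {K D : Set P} {Y : P → E → ℝ}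
    {G : E → ℝ≥0∞} (hDK : D ⊆ K) (hDc : D.Countable) (hKD : K ⊆ closure D)
    (hY : ∀ θ ∈ K, Measurable (Y θ)) (hpos : ∀ᵐ e ∂ν, ∀ θ ∈ K, 0 < Y θ e)
    (hcont : ∀ᵐ e ∂ν, ContinuousOn (fun θ => Y θ e) K)
    (hG : ∫⁻ e, G e ∂ν ≠ ∞)
    (hYG : ∀ᵐ e ∂ν, ∀ θ ∈ K, ENNReal.ofReal (Real.log (1 + Y θ e)) ≤ G e)
    {θ : P} (hθ : θ ∈ K)
    (hlt : ∫⁻ e, ENNReal.ofReal (Real.log (1 + Y θ e)) ∂ν < ENNReal.ofReal (Real.log 2)) :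
    ∃ δ > 0, ∃ W : E → ℝ, Measurable W ∧ Integrable W ν ∧ ∫ e, W e ∂ν < Real.log 2 ∧
      ∀ᵐ e ∂ν, ∀ ϑ ∈ K ∩ Metric.ball θ δ, Real.log (1 + Y ϑ e) ≤ W e := by
  let V : P → E → ℝ≥0∞ := fun ϑ e => ENNReal.ofReal (Real.log (1 + Y ϑ e))
  have hV : ∀ ϑ ∈ K, Measurable (V ϑ) := fun ϑ hϑ =>
    ((hY ϑ hϑ).const_add 1).log.ennreal_ofReal
  have hVcont : ∀ᵐ e ∂ν, ContinuousOn (fun ϑ => V ϑ e) K := by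
    filter_upwards [hpos, hcont] with e hp hc
    exact ENNReal.continuous_ofReal.comp_continuousOn
      ((continuousOn_const.add hc).log fun ϑ hϑ => (add_pos one_pos (hp ϑ hϑ)).ne')
  -- The supremum runs over the countable dense set to stay measurable; continuity in the parameter
  -- extends the bound to all of `K` (`hVW`). As the balls shrink it tends to `V θ`, and dominated
  -- convergence brings its integral below `log 2`.
  let W : ℕ → E → ℝ≥0∞ := fun j e => ⨆ ϑ ∈ D ∩ Metric.ball θ (1 / ((j : ℝ) + 1)), V ϑ e
  have hWm : ∀ j, Measurable (W j) := fun j =>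
    Measurable.biSup _ (hDc.mono Set.inter_subset_left) fun ϑ hϑ => hV ϑ (hDK hϑ.1)
  have hWG : ∀ j, ∀ᵐ e ∂ν, W j e ≤ G e := fun j => by
    filter_upwards [hYG] with e he
    exact iSup₂_le fun ϑ hϑ => he ϑ (hDK hϑ.1)
  have hVW : ∀ j : ℕ, ∀ᵐ e ∂ν, ∀ ϑ ∈ K ∩ Metric.ball θ (1 / ((j : ℝ) + 1)), V ϑ e ≤ W j e := fun j => by
    filter_upwards [hVcont] with e he ϑ hϑ
    have hmem : ϑ ∈ closure (D ∩ Metric.ball θ (1 / ((j : ℝ) + 1))) := by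
      rw [Set.inter_comm]
      exact Metric.isOpen_ball.inter_closure ⟨hϑ.2, hKD hϑ.1⟩
    have hcw : ContinuousWithinAt (fun ϑ => V ϑ e) (D ∩ Metric.ball θ (1 / ((j : ℝ) + 1))) ϑ :=
      (he ϑ hϑ.1).mono (Set.inter_subset_left.trans hDK)
    have : NeBot (𝓝[D ∩ Metric.ball θ (1 / ((j : ℝ) + 1))] ϑ) := mem_closure_iff_nhdsWithin_neBot.1 hmem
    refine le_of_tendsto hcw ?_
    filter_upwards [self_mem_nhdsWithin] with x hx
    exact le_iSup₂ (f := fun ϑ (_ : ϑ ∈ D ∩ Metric.ball θ (1 / ((j : ℝ) + 1))) => V ϑ e) x hx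
  have hWlim : ∀ᵐ e ∂ν, Tendsto (fun j => W j e) atTop (𝓝 (V θ e)) := by
    filter_upwards [hVcont, ae_all_iff.2 hVW] with e he hle
    refine tendsto_order.2 ⟨fun a ha => .of_forall fun j => ha.trans_le
      (hle j θ ⟨hθ, Metric.mem_ball_self (by positivity)⟩), fun a ha => ?_⟩
    obtain ⟨b, hb1, hb2⟩ := exists_between ha
    have hev := (he θ hθ).eventually (eventually_lt_nhds hb1)
    obtain ⟨δ, hδ, hsub⟩ := Metric.mem_nhdsWithin_iff.1 hev
    obtain ⟨n, hn⟩ := exists_nat_one_div_lt hδ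
    filter_upwards [eventually_ge_atTop n] with j hj
    refine lt_of_le_of_lt (iSup₂_le fun ϑ hϑ => ?_) hb2
    refine (hsub ⟨Metric.ball_subset_ball ?_ hϑ.2, hDK hϑ.1⟩).le
    exact (Nat.one_div_le_one_div hj).trans hn.le
  have hint : Tendsto (fun j => ∫⁻ e, W j e ∂ν) atTop (𝓝 (∫⁻ e, V θ e ∂ν)) :=
    tendsto_lintegral_of_dominated_convergence G hWm hWG hG hWlim
  obtain ⟨j, hj⟩ := (hint.eventually (eventually_lt_nhds hlt)).exists
  have hWfin : ∀ᵐ e ∂ν, W j e < ∞ := ae_lt_top (hWm j) (hj.trans ENNReal.ofReal_lt_top).ne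
  refine ⟨1 / ((j : ℝ) + 1), by positivity, fun e => (W j e).toReal, (hWm j).ennreal_toReal,
    integrable_toReal_of_lintegral_ne_top (hWm j).aemeasurable (hj.trans ENNReal.ofReal_lt_top).ne,
    ?_, ?_⟩
  · rw [integral_toReal (hWm j).aemeasurable hWfin]
    exact (ENNReal.lt_ofReal_iff_toReal_lt (hj.trans ENNReal.ofReal_lt_top).ne).1 hj
  · filter_upwards [hVW j, hWfin] with e he hfin ϑ hϑ
    exact (ENNReal.ofReal_le_iff_le_toReal hfin.ne).1 (he ϑ hϑ)

/-- Sample means of independent, identically distributed variables exceed a level above the mean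
with vanishing probability. -/
theorem tendsto_measure_avg_ge {Ω : Type*} [MeasurableSpace Ω] {μ : Measure Ω}
    [IsProbabilityMeasure μ] {T : ℕ → Ω → E} (hT : ∀ i, Measurable (T i))
    (hlaw : ∀ i, μ.map (T i) = ν) (hind : Pairwise fun i j => IndepFun (T i) (T j) μ)
    {W : E → ℝ} (hW : Measurable W) (hWi : Integrable W ν) {c : ℝ} (hc : ∫ e, W e ∂ν < c) :
    Tendsto (fun n : ℕ => μ {ω | c ≤ (∑ i ∈ Finset.range n, W (T i ω)) / n}) atTop (𝓝 0) := by
  have hint : Integrable (fun ω => W (T 0 ω)) μ := by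
    rw [← hlaw 0] at hWi
    exact hWi.comp_measurable (hT 0)
  have hmean : ∫ ω, W (T 0 ω) ∂μ = ∫ e, W e ∂ν := by
    rw [← hlaw 0, integral_map (hT 0).aemeasurable hW.aestronglyMeasurable]
  have hslln := strong_law_ae_real (fun i ω => W (T i ω)) hint
    (fun i j hij => (hind hij).comp hW hW)
    (fun i => IdentDistrib.comp (f := T i) (g := T 0)
      ⟨(hT i).aemeasurable, (hT 0).aemeasurable, by rw [hlaw, hlaw]⟩ hW)
  rw [hmean] at hslln
  have hmeas : ∀ n : ℕ, Measurable fun ω => (∑ i ∈ Finset.range n, W (T i ω)) / n := fun n => by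
    fun_prop
  have htm := tendstoInMeasure_of_tendsto_ae (fun n => (hmeas n).aestronglyMeasurable) hslln
  have hε : 0 < c - ∫ e, W e ∂ν := sub_pos.2 hc
  refine tendsto_of_tendsto_of_tendsto_of_le_of_le tendsto_const_nhds
    (htm (ENNReal.ofReal (c - ∫ e, W e ∂ν)) (ENNReal.ofReal_pos.2 hε)) (fun _ => zero_le)
    fun n => measure_mono fun ω hω => ?_
  simp only [Set.mem_ofPred_eq] at hω ⊢
  rw [edist_dist, Real.dist_eq]
  exact ENNReal.ofReal_le_ofReal ((sub_le_sub_right hω _).trans (le_abs_self _))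

/-- **Wald's consistency theorem**: estimators in a compact set whose likelihood is at least that
of the true parameter are consistent. The likelihood ratio is denoted `Y`. -/
theorem tendstoInMeasure_of_likelihood_ratio [IsProbabilityMeasure ν] {P : Type*} [PseudoMetricSpace P] {K : Set P}
    (hK : IsCompact K) {θ₀ : P} {Y : P → E → ℝ} {G : E → ℝ≥0∞}
    (hY : ∀ θ ∈ K, Measurable (Y θ)) (hpos : ∀ᵐ e ∂ν, ∀ θ ∈ K, 0 < Y θ e)
    (hcont : ∀ᵐ e ∂ν, ContinuousOn (fun θ => Y θ e) K)
    (hle : ∀ θ ∈ K, ∫⁻ e, ENNReal.ofReal (Y θ e) ∂ν ≤ 1)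
    (hid : ∀ θ ∈ K, Y θ =ᵐ[ν] (fun _ => 1) → θ = θ₀)
    (hG : ∫⁻ e, G e ∂ν ≠ ∞)
    (hYG : ∀ᵐ e ∂ν, ∀ θ ∈ K, ENNReal.ofReal (Real.log (1 + Y θ e)) ≤ G e)
    {Ω : Type*} [MeasurableSpace Ω] {μ : Measure Ω} [IsProbabilityMeasure μ] {T : ℕ → Ω → E}
    (hT : ∀ i, Measurable (T i)) (hlaw : ∀ i, μ.map (T i) = ν)
    (hind : Pairwise fun i j => IndepFun (T i) (T j) μ) {θhat : ℕ → Ω → P}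
    (hhat : ∀ n, ∀ᵐ ω ∂μ, θhat n ω ∈ K ∧
      0 ≤ ∑ i ∈ Finset.range n, Real.log (Y (θhat n ω) (T i ω))) :
    TendstoInMeasure μ θhat atTop fun _ => θ₀ := by
  obtain ⟨D, hDK, hDc, hKD⟩ := hK.isSeparable.exists_countable_dense_subset
  intro ε hε
  have hloc : ∀ θ ∈ K \ Metric.eball θ₀ ε, ∃ δ > 0, ∃ W : E → ℝ, Measurable W ∧ Integrable W ν ∧
      ∫ e, W e ∂ν < Real.log 2 ∧
      ∀ᵐ e ∂ν, ∀ ϑ ∈ K ∩ Metric.ball θ δ, Real.log (1 + Y ϑ e) ≤ W e := by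
    intro θ hθ
    refine exists_local_bound hDK hDc hKD hY hpos hcont hG hYG hθ.1
      (lintegral_log_one_add_lt (hY θ hθ.1) (hpos.mono fun e h => h θ hθ.1) (hle θ hθ.1)
        fun h => hθ.2 ?_)
    rw [hid θ hθ.1 h]
    exact Metric.mem_eball_self hε
  choose! δ hδ W hWm hWi hWlt hWle using hloc
  obtain ⟨s, hs, hcov⟩ := (hK.diff Metric.isOpen_eball).elim_nhds_subcover
    (fun θ => Metric.ball θ (δ θ)) (fun θ hθ => Metric.ball_mem_nhds θ (hδ θ hθ))
  have hlim : Tendsto (fun n : ℕ => ∑ θ ∈ s,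
      μ {ω | Real.log 2 ≤ (∑ i ∈ Finset.range n, W θ (T i ω)) / n}) atTop (𝓝 0) := by
    rw [show 𝓝 (0 : ℝ≥0∞) = 𝓝 (∑ _θ ∈ s, 0) by rw [Finset.sum_const_zero]]
    exact tendsto_finsetSum _ fun θ hθ =>
      tendsto_measure_avg_ge hT hlaw hind (hWm θ (hs θ hθ)) (hWi θ (hs θ hθ)) (hWlt θ (hs θ hθ))
  refine tendsto_of_tendsto_of_tendsto_of_le_of_le' tendsto_const_nhds hlim
    (.of_forall fun _ => zero_le) ?_
  -- For `n = 0` the average is `0 / 0 = 0`, below `log 2`, and the inclusion of events could fail.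
  filter_upwards [eventually_ge_atTop 1] with n hn
  refine le_trans (measure_mono_ae ?_) (measure_biUnion_finset_le s _)
  have hgood : ∀ᵐ e ∂ν, (∀ θ ∈ K, 0 < Y θ e) ∧
      ∀ θ ∈ s, ∀ ϑ ∈ K ∩ Metric.ball θ (δ θ), Real.log (1 + Y ϑ e) ≤ W θ e :=
    hpos.and ((ae_ball_iff s.countable_toSet).2 fun θ hθ => hWle θ (hs θ hθ))
  have hgoodT : ∀ᵐ ω ∂μ, ∀ i, (∀ θ ∈ K, 0 < Y θ (T i ω)) ∧
      ∀ θ ∈ s, ∀ ϑ ∈ K ∩ Metric.ball θ (δ θ), Real.log (1 + Y ϑ (T i ω)) ≤ W θ (T i ω) :=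
    ae_all_iff.2 fun i => ae_of_ae_map (hT i).aemeasurable (by rwa [hlaw i])
  filter_upwards [hgoodT, hhat n] with ω hω hhatω hmem
  obtain ⟨θ, hθs, hθ⟩ := Set.mem_iUnion₂.1 (hcov ⟨hhatω.1, not_lt.2 hmem⟩)
  refine Set.mem_biUnion (Finset.mem_coe.2 hθs) ?_
  have hn0 : (0 : ℝ) < n := by exact_mod_cast hn
  rw [Set.mem_ofPred_eq, le_div_iff₀ hn0]
  -- Here `θhat` lies in the ball around a centre `θ` of the finite cover. Its nonnegative
  -- log-likelihood ratio then forces the average of `W θ` up to `log 2`, an event of vanishing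
  -- probability.
  have hsum : ∑ i ∈ Finset.range n, Real.log (Y (θhat n ω) (T i ω)) ≤
      ∑ i ∈ Finset.range n, 2 * (W θ (T i ω) - Real.log 2) := by
    refine Finset.sum_le_sum fun i _ => ?_
    have h1 := log_le_two_mul_log_one_add ((hω i).1 _ hhatω.1)
    have h2 := (hω i).2 θ hθs _ ⟨hhatω.1, hθ⟩
    linarith
  rw [← Finset.mul_sum, Finset.sum_sub_distrib, Finset.sum_const, Finset.card_range,
    nsmul_eq_mul] at hsum
  linarith [hhatω.2]

end Wald

/-! ### Consistency of maximum likelihood estimators in a dominated model -/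

/-- Wald's theorem for the ratio `L θ / L θ₀` under the law with density `L θ₀`. Points where `L θ₀`
vanishes are null for that law; the common zero set makes the ratio positive elsewhere, and lets `Y
θ = 1` under the law imply `L θ = L θ₀` almost everywhere for `ρ`. -/
theorem tendstoInMeasure_of_likelihood {E P : Type*} [MeasurableSpace E] [PseudoMetricSpace P]
    {ρ : Measure E} {K : Set P} (hK : IsCompact K) {θ₀ : P} (hθ₀ : θ₀ ∈ K) {L : P → E → ℝ≥0∞}
    {G : E → ℝ≥0∞} (hL : ∀ θ ∈ K, Measurable (L θ)) (hmass : ∀ θ ∈ K, ∫⁻ e, L θ e ∂ρ ≤ 1)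
    (hfin : ∀ᵐ e ∂ρ, ∀ θ ∈ K, L θ e < ∞)
    (hzero : ∀ᵐ e ∂ρ, ∀ θ ∈ K, L θ e = 0 ↔ L θ₀ e = 0)
    (hcont : ∀ᵐ e ∂ρ, ContinuousOn (fun θ => L θ e) K)
    (hid : ∀ θ ∈ K, L θ =ᵐ[ρ] L θ₀ → θ = θ₀)
    (hG : ∫⁻ e, G e ∂(ρ.withDensity (L θ₀)) ≠ ∞)
    (hLG : ∀ᵐ e ∂ρ, L θ₀ e ≠ 0 → ∀ θ ∈ K,
      ENNReal.ofReal (Real.log (1 + (L θ e / L θ₀ e).toReal)) ≤ G e)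
    {Ω : Type*} [MeasurableSpace Ω] {μ : Measure Ω} [IsProbabilityMeasure μ] {T : ℕ → Ω → E}
    (hT : ∀ i, Measurable (T i)) (hlaw : ∀ i, μ.map (T i) = ρ.withDensity (L θ₀))
    (hind : Pairwise fun i j => IndepFun (T i) (T j) μ) {θhat : ℕ → Ω → P}
    (hhat : ∀ n, ∀ᵐ ω ∂μ, θhat n ω ∈ K ∧
      ∑ i ∈ Finset.range n, Real.log (L θ₀ (T i ω)).toReal ≤
        ∑ i ∈ Finset.range n, Real.log (L (θhat n ω) (T i ω)).toReal) :
    TendstoInMeasure μ θhat atTop fun _ => θ₀ := by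
  set ν := ρ.withDensity (L θ₀) with hν
  have hprob : IsProbabilityMeasure ν := by
    rw [← hlaw 0]
    exact Measure.isProbabilityMeasure_map (hT 0).aemeasurable
  have hL0 := hL θ₀ hθ₀
  have toν : ∀ {s : E → Prop}, (∀ᵐ e ∂ρ, L θ₀ e ≠ 0 → s e) → ∀ᵐ e ∂ν, s e := fun h =>
    (ae_withDensity_iff hL0).2 h
  have hgood : ∀ᵐ e ∂ν, L θ₀ e ≠ 0 ∧ ∀ θ ∈ K, L θ e ≠ ∞ ∧ L θ e ≠ 0 := by
    refine toν ?_
    filter_upwards [hfin, hzero] with e h1 h2 h0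
    exact ⟨h0, fun θ hθ => ⟨(h1 θ hθ).ne, fun h => h0 ((h2 θ hθ).1 h)⟩⟩
  refine tendstoInMeasure_of_likelihood_ratio (ν := ν) (Y := fun θ e => (L θ e / L θ₀ e).toReal)
    hK (fun θ hθ => ((hL θ hθ).div hL0).ennreal_toReal) ?_ ?_ ?_ ?_ hG (toν ?_) hT hlaw hind ?_
  · filter_upwards [hgood] with e he θ hθ
    exact ENNReal.toReal_pos (ENNReal.div_ne_zero.2 ⟨(he.2 θ hθ).2, (he.2 θ₀ hθ₀).1⟩)
      (ENNReal.div_ne_top (he.2 θ hθ).1 he.1)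
  · filter_upwards [hgood, toν (hcont.mono fun e h _ => h)] with e he hc θ hθ
    exact (ENNReal.tendsto_toReal (ENNReal.div_ne_top (he.2 θ hθ).1 he.1)).comp
      (ENNReal.Tendsto.div_const (hc θ hθ) (.inr he.1))
  · intro θ hθ
    have hm : Measurable fun e => ENNReal.ofReal (L θ e / L θ₀ e).toReal :=
      ((hL θ hθ).div hL0).ennreal_toReal.ennreal_ofReal
    rw [hν, lintegral_withDensity_eq_lintegral_mul _ hL0 hm]
    refine le_trans (lintegral_mono_ae (hfin.mono fun e h => ?_)) (hmass θ hθ)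
    simp only [Pi.mul_apply]
    refine (mul_le_mul_right ENNReal.ofReal_toReal_le (L θ₀ e)).trans ?_
    rcases eq_or_ne (L θ₀ e) 0 with h0 | h0
    · simp [h0]
    · rw [ENNReal.mul_div_cancel h0 (h θ₀ hθ₀).ne]
  · intro θ hθ h1
    refine hid θ hθ ?_
    filter_upwards [(ae_withDensity_iff hL0).1 h1, hfin, hzero] with e h1 h2 h3
    rcases eq_or_ne (L θ₀ e) 0 with h0 | h0
    · rw [h0, h3 θ hθ, h0]
    · have := h1 h0
      rwa [ENNReal.toReal_eq_one_iff, ENNReal.div_eq_one_iff h0 (h2 θ₀ hθ₀).ne] at this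
  · exact hLG
  · intro n
    have hgoodT : ∀ᵐ ω ∂μ, ∀ i, L θ₀ (T i ω) ≠ 0 ∧ ∀ θ ∈ K, L θ (T i ω) ≠ ∞ ∧ L θ (T i ω) ≠ 0 :=
      ae_all_iff.2 fun i => ae_of_ae_map (hT i).aemeasurable (by rwa [hlaw i])
    filter_upwards [hgoodT, hhat n] with ω hω h
    refine ⟨h.1, ?_⟩
    rw [← sub_nonneg, ← Finset.sum_sub_distrib] at h
    refine h.2.trans_eq (Finset.sum_congr rfl fun i _ => ?_)
    have h1 := (hω i).2 _ h.1
    have h2 := (hω i).2 _ hθ₀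
    rw [ENNReal.toReal_div, Real.log_div (ENNReal.toReal_pos h1.2 h1.1).ne'
      (ENNReal.toReal_pos h2.2 h2.1).ne']

/-! ### Measures on `ℝ × ℕ` -/

/-- The measure on `ℝ × ℕ` with given restrictions to the slices `ℝ × {r}`. -/
noncomputable def layered (b : ℕ → Measure ℝ) : Measure (ℝ × ℕ) :=
  Measure.sum fun r => (b r).map fun x => (x, r)

theorem lintegral_layered (b : ℕ → Measure ℝ) {F : ℝ × ℕ → ℝ≥0∞} (hF : Measurable F) :
    ∫⁻ e, F e ∂(layered b) = ∑' r, ∫⁻ x, F (x, r) ∂(b r) := by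
  rw [layered, lintegral_sum_measure]
  exact tsum_congr fun r => lintegral_map hF (by fun_prop)

theorem ae_layered_iff {b : ℕ → Measure ℝ} {s : ℝ × ℕ → Prop} :
    (∀ᵐ e ∂(layered b), s e) ↔ ∀ r, ∀ᵐ x ∂(b r), s (x, r) := by
  rw [layered, Measure.ae_sum_iff]
  exact forall_congr' fun r => (measurableEmbedding_prod_mk_right r).ae_map_iff

/-! ### Domination over a compact set of parameters -/

theorem IsRegular.mono {P : Type*} [TopologicalSpace P] {g : P → ℝ → ℝ≥0∞} {Θ K : Set P}
    (h : IsRegular g Θ) (hK : K ⊆ Θ) : IsRegular g K where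
  measurable θ hθ := h.measurable θ (hK hθ)
  lintegral_eq_one θ hθ := h.lintegral_eq_one θ (hK hθ)
  eq_zero_of_neg θ hθ := h.eq_zero_of_neg θ (hK hθ)
  common_support := h.common_support.mono fun _ hx θ hθ θ' hθ' => hx θ (hK hθ) θ' (hK hθ')
  continuousOn := h.continuousOn.mono fun _ hx => hx.mono hK
  locally_dominated θ hθ := by
    obtain ⟨U, hU, H⟩ := h.locally_dominated θ (hK hθ)
    exact ⟨U, nhdsWithin_mono θ hK hU, H⟩

/-- Finitely many local bounds suffice by compactness, and their sum dominates them all. -/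
theorem IsRegular.exists_dominating {P : Type*} [TopologicalSpace P] {g : P → ℝ → ℝ≥0∞}
    {K : Set P} (h : IsRegular g K) (hK : IsCompact K) :
    ∃ H : ℝ → ℝ≥0∞, Measurable H ∧ ∫⁻ x, H x ≠ ∞ ∧ ∀ᵐ x : ℝ, ∀ θ ∈ K, g θ x ≤ H x := by
  refine hK.induction_on (p := fun s => ∃ H : ℝ → ℝ≥0∞, Measurable H ∧ ∫⁻ x, H x ≠ ∞ ∧
    ∀ᵐ x : ℝ, ∀ θ ∈ s, g θ x ≤ H x) ?_ ?_ ?_ ?_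
  · exact ⟨0, measurable_zero, by simp, by simp⟩
  · rintro s t hst ⟨H, h1, h2, h3⟩
    exact ⟨H, h1, h2, h3.mono fun x hx θ hθ => hx θ (hst hθ)⟩
  · rintro s t ⟨H, h1, h2, h3⟩ ⟨H', h1', h2', h3'⟩
    refine ⟨H + H', h1.add h1', ?_, ?_⟩
    · simp only [Pi.add_apply]
      rw [lintegral_add_left h1]
      exact ENNReal.add_ne_top.2 ⟨h2, h2'⟩
    · filter_upwards [h3, h3'] with x hx hx'
      rintro θ (hθ | hθ)
      · exact (hx θ hθ).trans le_self_add
      · exact (hx' θ hθ).trans le_add_self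
  · intro θ hθ
    obtain ⟨U, hU, H, h1, h2, h3⟩ := h.locally_dominated θ hθ
    exact ⟨U, hU, H, h1, h2, h3⟩

/-! ### Counting sets of retained packets -/

/-- The number of inter-renewals between the first and the last element of `R`. -/
def spread (R : Finset ℕ) : ℕ := if h : R.Nonempty then R.max' h - R.min' h else 0

theorem spread_eq_of_isLeast_of_isGreatest {R : Finset ℕ} {a b : ℕ} (ha : IsLeast (R : Set ℕ) a)
    (hb : IsGreatest (R : Set ℕ) b) : spread R = b - a := by
  have h : R.Nonempty := ⟨a, ha.1⟩
  rw [spread, dif_pos h, (R.isGreatest_max' h).unique hb, (R.isLeast_min' h).unique ha]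

theorem spread_eq_zero {R : Finset ℕ} (h : R.card < 2) : spread R = 0 := by
  have h' : R.card ≤ 1 := by omega
  rcases Finset.card_le_one_iff_subset_singleton.1 h' with ⟨a, ha⟩
  rcases Finset.subset_singleton_iff.1 ha with rfl | rfl <;> simp [spread]

/-- Such a set consists of its minimum `a`, with `m + 1 - k` choices, its maximum `a + k`, and `r -
2` of the `k - 1` points strictly between. This is the numerator of `upsilon`. -/
theorem card_powersetCard_spread_eq {m k r : ℕ} (hr : 2 ≤ r) (hk : 1 ≤ k) :
    (((Finset.range (m + 1)).powersetCard r).filter (fun R => spread R = k)).card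
      = (m + 1 - k) * (k - 1).choose (r - 2) := by
  have hcard : ((Finset.range (m + 1 - k)).sigma
      fun a => (Finset.Ioo a (a + k)).powersetCard (r - 2)).card
      = (m + 1 - k) * (k - 1).choose (r - 2) := by
    rw [Finset.card_sigma]
    have hIoo : ∀ a : ℕ, a + k - a - 1 = k - 1 := fun a => by omega
    simp only [Finset.card_powersetCard, Nat.card_Ioo, hIoo, Finset.sum_const, Finset.card_range,
      smul_eq_mul]
  have hends : ∀ (a : ℕ) (T : Finset ℕ), T ⊆ Finset.Ioo a (a + k) →
      IsLeast (insert a (insert (a + k) T) : Finset ℕ) a ∧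
      IsGreatest (insert a (insert (a + k) T) : Finset ℕ) (a + k) := by
    intro a T hT
    refine ⟨⟨by simp, fun x hx => ?_⟩, ⟨by simp, fun x hx => ?_⟩⟩ <;>
    · rw [Finset.mem_coe, Finset.mem_insert, Finset.mem_insert] at hx
      rcases hx with rfl | rfl | hx
      · omega
      · omega
      · have := Finset.mem_Ioo.1 (hT hx); omega
  rw [← hcard]
  symm
  refine Finset.card_bij (fun c _ => insert c.1 (insert (c.1 + k) c.2)) ?_ ?_ ?_
  · rintro ⟨a, T⟩ hc
    simp only [Finset.mem_sigma, Finset.mem_range, Finset.mem_powersetCard] at hc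
    obtain ⟨ha, hT, hTc⟩ := hc
    have he := hends a T hT
    dsimp only
    rw [Finset.mem_filter, Finset.mem_powersetCard]
    refine ⟨⟨fun x hx => ?_, ?_⟩, ?_⟩
    · have := he.2.2 hx
      rw [Finset.mem_range]; omega
    · rw [Finset.card_insert_of_notMem, Finset.card_insert_of_notMem, hTc]
      · omega
      · exact fun h => by have := Finset.mem_Ioo.1 (hT h); omega
      · rw [Finset.mem_insert]
        rintro (h | h)
        · omega
        · have := Finset.mem_Ioo.1 (hT h); omega
    · rw [spread_eq_of_isLeast_of_isGreatest he.1 he.2]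
      simp
  · rintro ⟨a, T⟩ hc ⟨a', T'⟩ hc' heq
    simp only [Finset.mem_sigma, Finset.mem_powersetCard] at hc hc'
    simp only at heq
    have he := hends a T hc.2.1
    have he' := hends a' T' hc'.2.1
    rw [heq] at he
    obtain rfl : a = a' := he.1.unique he'.1
    have hnot : ∀ T : Finset ℕ, T ⊆ Finset.Ioo a (a + k) →
        T = (insert a (insert (a + k) T)).filter (· ∈ Finset.Ioo a (a + k)) := by
      intro T hT
      ext x
      rw [Finset.mem_filter, Finset.mem_insert, Finset.mem_insert, Finset.mem_Ioo]
      constructor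
      · intro h
        exact ⟨.inr (.inr h), Finset.mem_Ioo.1 (hT h)⟩
      · rintro ⟨rfl | rfl | h, h'⟩
        · omega
        · omega
        · exact h
    rw [hnot T hc.2.1, hnot T' hc'.2.1, heq]
  · intro R hR
    rw [Finset.mem_filter, Finset.mem_powersetCard] at hR
    obtain ⟨⟨hRm, hRr⟩, hRk⟩ := hR
    have hne : R.Nonempty := Finset.card_pos.1 (by omega)
    rw [spread, dif_pos hne] at hRk
    have hmin := R.min'_mem hne
    have hmax := R.max'_mem hne
    set a := R.min' hne with ha
    set b := R.max' hne with hb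
    have hab : b = a + k := by omega
    have hbm := Finset.mem_range.1 (hRm hmax)
    refine ⟨⟨a, (R.erase a).erase b⟩, ?_, ?_⟩
    · simp only [Finset.mem_sigma, Finset.mem_range, Finset.mem_powersetCard]
      refine ⟨by omega, fun x hx => ?_, ?_⟩
      · rw [Finset.mem_erase, Finset.mem_erase] at hx
        have h1 := R.min'_le x hx.2.2
        have h2 := R.le_max' x hx.2.2
        rw [Finset.mem_Ioo]; omega
      · rw [Finset.card_erase_of_mem, Finset.card_erase_of_mem hmin]
        · omega
        · exact Finset.mem_erase.2 ⟨by omega, hmax⟩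
    · simp only
      rw [← hab, Finset.insert_erase, Finset.insert_erase hmin]
      exact Finset.mem_erase.2 ⟨by omega, hmax⟩

theorem sum_powersetCard_spread {A : Type*} [AddCommMonoid A] (φ : ℕ → A) {m r : ℕ} (hr : 2 ≤ r) :
    ∑ R ∈ (Finset.range (m + 1)).powersetCard r, φ (spread R)
      = ∑ k ∈ Finset.Icc (r - 1) m, ((m + 1 - k) * (k - 1).choose (r - 2)) • φ k := by
  have hmaps : ∀ R ∈ (Finset.range (m + 1)).powersetCard r, spread R ∈ Finset.Icc (r - 1) m := by
    intro R hR
    rw [Finset.mem_powersetCard] at hR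
    have hne : R.Nonempty := Finset.card_pos.1 (by omega)
    rw [spread, dif_pos hne, Finset.mem_Icc]
    have hb := Finset.mem_range.1 (hR.1 (R.max'_mem hne))
    have hsub : R ⊆ Finset.Icc (R.min' hne) (R.max' hne) := fun x hx =>
      Finset.mem_Icc.2 ⟨R.min'_le x hx, R.le_max' x hx⟩
    have := Finset.card_le_card hsub
    rw [Nat.card_Icc] at this
    omega
  rw [← Finset.sum_fiberwise_of_maps_to hmaps]
  refine Finset.sum_congr rfl fun k hk => ?_
  rw [Finset.mem_Icc] at hk
  rw [Finset.sum_congr rfl (g := fun _ => φ k) (fun R hR => by rw [(Finset.mem_filter.1 hR).2]),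
    Finset.sum_const, card_powersetCard_spread_eq hr (by omega)]

/-! ### Laws of sums and mixtures -/

section Law

variable {Ω : Type*} [MeasurableSpace Ω] {μ : Measure Ω} [IsProbabilityMeasure μ]

/-- The law depends only on the number `k` of summands, not on their position `a`. The indices start
at `a + 1`, so the first inter-renewal time, whose law is different, never enters. -/
theorem map_sum_Ioc {X : ℕ → Ω → ℝ} {g₀ : ℝ → ℝ≥0∞} (hg : Measurable g₀)
    (hX : ∀ j, Measurable (X j)) (hlaw : ∀ j, 1 ≤ j → HasLaw (X j) (volume.withDensity g₀) μ)
    (hind : iIndepFun X μ) (a k : ℕ) :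
    μ.map (fun ω => ∑ j ∈ Finset.Ioc a (a + k), X j ω)
      = (convBase k).withDensity (selfConv g₀ k) := by
  match k with
  | 0 =>
    refine Measure.ext fun s hs => ?_
    rw [withDensity_apply _ hs]
    simp only [add_zero, Finset.Ioc_self, Finset.sum_empty, Measure.map_const, measure_univ,
      one_smul, convBase, if_true, selfConv]
    classical
    rw [setLIntegral_dirac]
    by_cases h : (0 : ℝ) ∈ s <;> simp [h, hs]
  | 1 =>
    have : Finset.Ioc a (a + 1) = {a + 1} := by
      ext x
      simp only [Finset.mem_Ioc, Finset.mem_singleton]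
      omega
    simp only [this, Finset.sum_singleton]
    exact (hlaw (a + 1) (by omega)).map_eq
  | k + 2 =>
    have ih := map_sum_Ioc hg hX hlaw hind a (k + 1)
    have hsplit : (fun ω => ∑ j ∈ Finset.Ioc a (a + (k + 2)), X j ω)
        = (∑ j ∈ Finset.Ioc a (a + (k + 1)), X j) + X (a + (k + 1) + 1) := by
      ext ω
      rw [← add_assoc, show a + k + 2 = a + (k + 1) + 1 by ring,
        Finset.sum_Ioc_succ_top (by omega)]
      simp
    have hsum : (∑ j ∈ Finset.Ioc a (a + (k + 1)), X j)
        = fun ω => ∑ j ∈ Finset.Ioc a (a + (k + 1)), X j ω := by ext ω; simp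
    have hi : IndepFun (∑ j ∈ Finset.Ioc a (a + (k + 1)), X j) (X (a + (k + 1) + 1)) μ :=
      hind.indepFun_finsetSum_of_notMem hX (by simp)
    rw [hsplit, hi.map_add_eq_map_conv_map₀ (by rw [hsum]; fun_prop) (by fun_prop), hsum, ih,
      (hlaw _ (by omega)).map_eq]
    simp only [convBase, Nat.add_eq_zero_iff, one_ne_zero, OfNat.ofNat_ne_zero,
      and_false, if_false]
    exact conv_withDensity_eq_lconvolution (measurable_selfConv hg (k + 1)) hg

theorem lintegral_comp_sum_Ioc {X : ℕ → Ω → ℝ} {g₀ : ℝ → ℝ≥0∞} (hg : Measurable g₀)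
    (hX : ∀ j, Measurable (X j)) (hlaw : ∀ j, 1 ≤ j → HasLaw (X j) (volume.withDensity g₀) μ)
    (hind : iIndepFun X μ) (a k : ℕ) {F : ℝ → ℝ≥0∞} (hF : Measurable F) :
    ∫⁻ ω, F (∑ j ∈ Finset.Ioc a (a + k), X j ω) ∂μ
      = ∫⁻ x, selfConv g₀ k x * F x ∂(convBase k) := by
  rw [← lintegral_map (f := F) hF (g := fun ω => ∑ j ∈ Finset.Ioc a (a + k), X j ω) (by fun_prop),
    map_sum_Ioc hg hX hlaw hind,
    lintegral_withDensity_eq_lintegral_mul _ (measurable_selfConv hg k) hF]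
  rfl

/-- Integration against a discrete variable and an independent one. -/
theorem lintegral_indepFun_countable {α β : Type*} [MeasurableSpace α] [Countable α]
    [MeasurableSingletonClass α] [MeasurableSpace β] {N : Ω → α} {Z : Ω → β} (hN : Measurable N)
    (hZ : Measurable Z) (h : IndepFun N Z μ) {Φ : α → β → ℝ≥0∞} (hΦ : ∀ a, Measurable (Φ a)) :
    ∫⁻ ω, Φ (N ω) (Z ω) ∂μ = ∑' a, μ (N ⁻¹' {a}) * ∫⁻ ω, Φ a (Z ω) ∂μ := by
  have hΦ' : Measurable (Function.uncurry Φ) := measurable_from_prod_countable_right hΦ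
  calc ∫⁻ ω, Φ (N ω) (Z ω) ∂μ = ∫⁻ z, Function.uncurry Φ z ∂(μ.map fun ω => (N ω, Z ω)) := by
        rw [lintegral_map hΦ' (hN.prodMk hZ)]
        rfl
    _ = ∫⁻ a, ∫⁻ z, Φ a z ∂(μ.map Z) ∂(μ.map N) := by
        have := Measure.isProbabilityMeasure_map (μ := μ) hN.aemeasurable
        have := Measure.isProbabilityMeasure_map (μ := μ) hZ.aemeasurable
        rw [(indepFun_iff_map_prod_eq_prod_map_map hN.aemeasurable hZ.aemeasurable).1 h,
          lintegral_prod _ hΦ'.aemeasurable]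
        rfl
    _ = _ := by
        rw [lintegral_countable']
        refine tsum_congr fun a => ?_
        rw [Measure.map_apply hN (measurableSet_singleton a), lintegral_map (hΦ a) hZ, mul_comm]

end Law

/-! ### The laws of the symbols -/

/-- The reference measure for durations of flows with `r` packets. -/
noncomputable def symbolBase (r : ℕ) : Measure ℝ := if r = 0 then 0 else convBase (r - 1)

/-- The reference measure for sampled durations of flows with `r` retained packets. -/
noncomputable def sampledBase (r : ℕ) : Measure ℝ := if r < 2 then Measure.dirac 0 else volume

/-- The factor of the likelihood which comes from the duration and the size of a flow. -/
noncomputable def durationLikelihood (p : PMF ℕ) (g : ℝ → ℝ≥0∞) (e : ℝ × ℕ) : ℝ≥0∞ :=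
  selfConv g (e.2 - 1) e.1 * p (e.2 - 1)

theorem measurable_durationLikelihood (p : PMF ℕ) {g : ℝ → ℝ≥0∞} (hg : Measurable g) :
    Measurable (durationLikelihood p g) :=
  measurable_from_prod_countable_left fun r => (measurable_selfConv hg (r - 1)).mul_const (p (r - 1))

theorem measurable_sampledLikelihood (p : PMF ℕ) (q : ℝ) {g : ℝ → ℝ≥0∞} (hg : Measurable g) :
    Measurable fun e : ℝ × ℕ => sampledLikelihood p q g (0, e) := by
  refine measurable_from_prod_countable_left fun r => ?_
  have := measurable_selfConv hg
  simp only [sampledLikelihood]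
  split_ifs
  · exact measurable_const
  · fun_prop

section Session

variable {Ω : Type*} [MeasurableSpace Ω] {μ : Measure Ω} {f g₀ : ℝ → ℝ≥0∞}
  {p : PMF ℕ} {q : ℝ} {M : ℕ → Ω → ℕ} {X : ℕ → ℕ → Ω → ℝ} {B : ℕ → ℕ → Ω → Bool}

theorem measurable_symbol (h : IsSession μ f g₀ p q M X B) (i : ℕ) :
    Measurable fun ω => symbol (fun j => X i j ω) (M i ω) := by
  have hΦ : Measurable (Function.uncurry fun (m : ℕ) (x : ℕ → ℝ) => symbol x m) := by
    refine measurable_from_prod_countable_right fun m => ?_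
    simp only [Function.uncurry, symbol]
    fun_prop
  exact hΦ.comp ((h.measurable_size i).prodMk (measurable_pi_lambda _ (h.measurable_time i)))

theorem measurable_sampledSymbol (R : Finset ℕ) :
    Measurable fun x : ℕ → ℝ => sampledSymbol x R := by
  unfold sampledSymbol
  split_ifs <;> fun_prop

theorem measurableSet_retained_eq (m : ℕ) (R : Finset ℕ) :
    MeasurableSet {b : ℕ → Bool | retained b m = R} := by
  have : {b : ℕ → Bool | retained b m = R}
      = ⋂ j : ℕ, {b | (j ∈ Finset.range (m + 1) ∧ b j = true) ↔ j ∈ R} := by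
    ext b
    simp [retained, Finset.ext_iff]
  rw [this]
  refine MeasurableSet.iInter fun j => ?_
  have : MeasurableSet {c : Bool | (j ∈ Finset.range (m + 1) ∧ c = true) ↔ j ∈ R} := .of_discrete
  exact measurable_pi_apply (X := fun _ : ℕ => Bool) j this

theorem measurable_sampledSymbol_retained :
    Measurable fun z : ℕ × (ℕ → ℝ) × (ℕ → Bool) => sampledSymbol z.2.1 (retained z.2.2 z.1) := by
  -- Finite sets form a countable type; with the discrete σ-algebra, joint measurability can be
  -- checked on each retained set separately.
  let _ : MeasurableSpace (Finset ℕ) := ⊤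
  have hR : Measurable fun z : ℕ × (ℕ → ℝ) × (ℕ → Bool) => retained z.2.2 z.1 := by
    refine measurable_from_prod_countable_right fun m => ?_
    have : Measurable fun b : ℕ → Bool => retained b m :=
      measurable_to_countable' fun R => measurableSet_retained_eq m R
    exact this.comp measurable_snd
  have hΦ : Measurable (Function.uncurry fun (R : Finset ℕ) (x : ℕ → ℝ) => sampledSymbol x R) :=
    measurable_from_prod_countable_right measurable_sampledSymbol
  exact hΦ.comp (hR.prodMk (measurable_fst.comp measurable_snd))

theorem measurable_sampledSymbol_session (h : IsSession μ f g₀ p q M X B) (i : ℕ) :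
    Measurable fun ω => sampledSymbol (fun j => X i j ω)
      (retained (fun j => B i j ω) (M i ω)) :=
  measurable_sampledSymbol_retained.comp ((h.measurable_size i).prodMk
    ((measurable_pi_lambda _ (h.measurable_time i)).prodMk
      (measurable_pi_lambda _ (h.measurable_mark i))))

theorem measure_size_eq (h : IsSession μ f g₀ p q M X B) (i m : ℕ) :
    μ (M i ⁻¹' {m}) = p m := by
  rw [← Measure.map_apply (h.measurable_size i) (measurableSet_singleton m), (h.law_size i).map_eq,
    PMF.toMeasure_apply_singleton _ _ (measurableSet_singleton m)]

variable [IsProbabilityMeasure μ]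

theorem lintegral_symbol (h : IsSession μ f g₀ p q M X B) (hg : Measurable g₀) (i : ℕ)
    {F : ℝ × ℕ → ℝ≥0∞} (hF : Measurable F) :
    ∫⁻ ω, F (symbol (fun j => X i j ω) (M i ω)).2 ∂μ
      = ∫⁻ e, F e ∂((layered symbolBase).withDensity (durationLikelihood p g₀)) := by
  have hL := measurable_durationLikelihood p hg
  have hΦ : ∀ m, Measurable fun x : ℕ → ℝ => F (symbol x m).2 := fun m => by
    simp only [symbol]
    fun_prop
  rw [lintegral_indepFun_countable (h.measurable_size i)
    (measurable_pi_lambda _ (h.measurable_time i)) ((h.indep_size i).comp measurable_id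
      measurable_fst) hΦ, lintegral_withDensity_eq_lintegral_mul _ hL hF,
    lintegral_layered _ (hL.mul hF)]
  -- The layer of packet count `0` carries no mass, so the layers are indexed by `m + 1`.
  refine Eq.trans ?_ (tsum_eq_zero_add' ENNReal.summable).symm
  simp only [symbolBase, if_true, lintegral_zero_measure, zero_add]
  refine tsum_congr fun m => ?_
  have hFm : Measurable fun x => F (x, m + 1) := by fun_prop
  have := lintegral_comp_sum_Ioc hg (h.measurable_time i) (h.law_time i) (h.indep_time i) 0 m hFm
  have hIcc : Finset.Ioc 0 (0 + m) = Finset.Icc 1 m := by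
    rw [zero_add]; rfl
  rw [hIcc] at this
  simp only [symbol]
  rw [measure_size_eq h, this]
  simp only [Nat.add_eq_zero_iff, one_ne_zero, and_false, if_false, Nat.add_sub_cancel,
    durationLikelihood, Pi.mul_apply]
  have hsc := measurable_selfConv hg m
  rw [← lintegral_const_mul _ (by fun_prop)]
  refine lintegral_congr fun x => ?_
  ring

theorem map_symbol (h : IsSession μ f g₀ p q M X B) (hg : Measurable g₀) (i : ℕ) :
    μ.map (fun ω => (symbol (fun j => X i j ω) (M i ω)).2)
      = (layered symbolBase).withDensity (durationLikelihood p g₀) := by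
  refine Measure.ext_of_lintegral _ fun F hF => ?_
  rw [lintegral_map hF (measurable_symbol h i).snd, lintegral_symbol h hg i hF]

/-- The retained set is `R` exactly when each of the `m + 1` independent marks agrees with
membership in `R`. -/
theorem measure_retained_eq (h : IsSession μ f g₀ p q M X B) (hq : q ∈ Set.Ioo (0 : ℝ) 1)
    (i m : ℕ) {R : Finset ℕ} (hR : R ⊆ Finset.range (m + 1)) :
    μ ((fun ω => retained (fun j => B i j ω) m) ⁻¹' {R})
      = ENNReal.ofReal (q ^ R.card * (1 - q) ^ (m + 1 - R.card)) := by
  have hset : (fun ω => retained (fun j => B i j ω) m) ⁻¹' {R}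
      = ⋂ j ∈ Finset.range (m + 1), B i j ⁻¹' {decide (j ∈ R)} := by
    ext ω
    simp only [Set.mem_preimage, Set.mem_singleton_iff, retained, Finset.ext_iff,
      Finset.mem_filter, Set.mem_iInter]
    refine ⟨fun H j hj => ?_, fun H j => ⟨fun hj => ?_, fun hj => ?_⟩⟩
    · have := H j
      rw [Bool.eq_iff_iff, decide_eq_true_iff]
      tauto
    · simpa [hj.2] using H j hj.1
    · exact ⟨hR hj, by simpa [hj] using H j (hR hj)⟩
  have htrue : ∀ j, μ (B i j ⁻¹' {true}) = ENNReal.ofReal q := fun j => h.law_mark i j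
  have hfalse : ∀ j, μ (B i j ⁻¹' {false}) = ENNReal.ofReal (1 - q) := fun j => by
    have : B i j ⁻¹' {false} = (B i j ⁻¹' {true})ᶜ := by ext; simp
    rw [this, prob_compl_eq_one_sub (h.measurable_mark i j (measurableSet_singleton _)), htrue,
      ENNReal.ofReal_sub _ hq.1.le, ENNReal.ofReal_one]
  rw [hset, (h.indep_mark i).measure_inter_preimage_eq_mul _ (fun j _ => measurableSet_singleton _)]
  have hprod : ∀ j ∈ Finset.range (m + 1), μ (B i j ⁻¹' {decide (j ∈ R)})
      = if j ∈ R then ENNReal.ofReal q else ENNReal.ofReal (1 - q) := fun j _ => by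
    by_cases hj : j ∈ R <;> simp only [hj, decide_true, decide_false, if_true, if_false,
      htrue, hfalse]
  rw [Finset.prod_congr rfl hprod, Finset.prod_ite, Finset.prod_const, Finset.prod_const,
    Finset.filter_mem_eq_inter, Finset.inter_eq_right.2 hR, Finset.filter_notMem_eq_sdiff,
    Finset.card_sdiff_of_subset hR, Finset.card_range,
    ENNReal.ofReal_mul (pow_nonneg hq.1.le _), ENNReal.ofReal_pow hq.1.le,
    ENNReal.ofReal_pow (sub_nonneg.2 hq.2.le)]

/-- For a fixed retained set the sampled duration is a sum of `spread R` consecutive inter-renewal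
times. The value `(0, 0, 0)` for the empty set agrees with spread `0` and the unit mass at `0`. -/
theorem lintegral_sampledSymbol_of_finset (h : IsSession μ f g₀ p q M X B) (hg : Measurable g₀)
    (i : ℕ) (R : Finset ℕ) {F : ℝ × ℕ → ℝ≥0∞} (hF : Measurable F) :
    ∫⁻ ω, F (sampledSymbol (fun j => X i j ω) R).2 ∂μ
      = ∫⁻ x, selfConv g₀ (spread R) x * F (x, R.card) ∂(convBase (spread R)) := by
  by_cases hne : R.Nonempty
  · have hFR : Measurable fun x => F (x, R.card) := by fun_prop
    have := lintegral_comp_sum_Ioc hg (h.measurable_time i) (h.law_time i) (h.indep_time i)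
      (R.min' hne) (spread R) hFR
    rw [← this]
    simp only [sampledSymbol, spread, dif_pos hne]
    rw [Nat.add_sub_cancel' (R.min'_le _ (R.max'_mem hne))]
  · rw [Finset.not_nonempty_iff_eq_empty] at hne
    subst hne
    have h0 : spread ∅ = 0 := spread_eq_zero (by simp)
    simp [h0, sampledSymbol, convBase, selfConv]

theorem tau_mul_upsilon {m r k : ℕ} (hr : 2 ≤ r) (hk : k ∈ Finset.Icc (r - 1) m) :
    tau q m r * upsilon m k r = (((m + 1 - k) * (k - 1).choose (r - 2) : ℕ) : ℝ) *
      (q ^ r * (1 - q) ^ (m + 1 - r)) := by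
  rw [Finset.mem_Icc] at hk
  have hc : ((m + 1).choose r : ℝ) ≠ 0 := by
    exact_mod_cast (Nat.choose_pos (by omega)).ne'
  rw [tau, upsilon, Nat.cast_mul, Nat.cast_sub (by omega)]
  push_cast
  field_simp

/-- Condition on the flow size, then on the retained set. The conditional law sees only the
cardinality and the spread of that set, so grouping by these two numbers produces the coefficients
`tau * upsilon`. -/
theorem lintegral_sampledSymbol (h : IsSession μ f g₀ p q M X B) (hg : Measurable g₀)
    (hq : q ∈ Set.Ioo (0 : ℝ) 1) (i : ℕ) {F : ℝ × ℕ → ℝ≥0∞} (hF : Measurable F) :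
    ∫⁻ ω, F (sampledSymbol (fun j => X i j ω) (retained (fun j => B i j ω) (M i ω))).2 ∂μ
      = ∫⁻ e, F e ∂((layered sampledBase).withDensity
          (fun e => sampledLikelihood p q g₀ (0, e))) := by
  have hL := measurable_sampledLikelihood p q hg
  set w : ℕ → ℕ → ℝ≥0∞ := fun m r => ENNReal.ofReal (q ^ r * (1 - q) ^ (m + 1 - r)) with hw
  set φ : ℕ → ℕ → ℝ≥0∞ := fun r k => ∫⁻ x, selfConv g₀ k x * F (x, r) ∂(convBase k) with hφ
  have hΦ : ∀ m, Measurable fun z : (ℕ → ℝ) × (ℕ → Bool) =>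
      F (sampledSymbol z.1 (retained z.2 m)).2 := fun m =>
    hF.comp (measurable_snd.comp (measurable_sampledSymbol_retained.comp
      (measurable_const.prodMk measurable_id)))
  have hm : ∀ m, ∫⁻ ω, F (sampledSymbol (fun j => X i j ω) (retained (fun j => B i j ω) m)).2 ∂μ
      = ∑' r, ∑ R ∈ (Finset.range (m + 1)).powersetCard r, w m r * φ r (spread R) := by
    intro m
    let _ : MeasurableSpace (Finset ℕ) := ⊤
    have hR : Measurable fun b : ℕ → Bool => retained b m :=
      measurable_to_countable' fun R => measurableSet_retained_eq m R
    have hB := measurable_pi_lambda _ (h.measurable_mark i)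
    rw [lintegral_indepFun_countable (N := fun ω => retained (fun j => B i j ω) m)
      (Φ := fun R x => F (sampledSymbol x R).2) (hR.comp hB)
      (measurable_pi_lambda _ (h.measurable_time i))
      ((h.indep_time_mark i).symm.comp hR measurable_id)
      (fun R => hF.comp (measurable_sampledSymbol R).snd)]
    rw [tsum_eq_sum (s := (Finset.range (m + 1)).powerset), Finset.sum_powerset,
      tsum_eq_sum (s := Finset.range ((Finset.range (m + 1)).card + 1))]
    · refine Finset.sum_congr rfl fun r _ => Finset.sum_congr rfl fun R hR => ?_
      rw [Finset.mem_powersetCard] at hR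
      rw [measure_retained_eq h hq i m hR.1, lintegral_sampledSymbol_of_finset h hg i R hF, hR.2]
    · intro r hr
      rw [Finset.mem_range, not_lt] at hr
      rw [Finset.powersetCard_eq_empty.2 (by omega), Finset.sum_empty]
    · intro R hR
      rw [Finset.mem_powerset] at hR
      have : (fun ω => retained (fun j => B i j ω) m) ⁻¹' {R} = ∅ := by
        refine Set.eq_empty_of_forall_notMem fun ω hω => hR ?_
        rw [← (Set.mem_singleton_iff.1 hω)]
        exact Finset.filter_subset _ _
      rw [this, measure_empty, zero_mul]
  rw [lintegral_indepFun_countable (h.measurable_size i)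
    ((measurable_pi_lambda _ (h.measurable_time i)).prodMk
      (measurable_pi_lambda _ (h.measurable_mark i))) (h.indep_size i) hΦ,
    lintegral_withDensity_eq_lintegral_mul _ hL hF, lintegral_layered _ (hL.mul hF)]
  simp only [hm, measure_size_eq h, ← ENNReal.tsum_mul_left]
  rw [ENNReal.tsum_comm]
  refine tsum_congr fun r => ?_
  simp only [Pi.mul_apply, sampledBase, sampledLikelihood]
  rcases lt_or_ge r 2 with hr | hr
  -- With at most one retained packet the spread is `0` and the whole layer is an atom at `0`.
  · simp only [if_pos hr]
    rw [lintegral_dirac, ← ENNReal.tsum_mul_right]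
    refine tsum_congr fun m => ?_
    have h0 : φ r 0 = F (0, r) := by simp [hφ, convBase, selfConv]
    rw [Finset.sum_congr rfl (g := fun _ => w m r * φ r 0) fun R hR => by
        rw [spread_eq_zero (by rw [(Finset.mem_powersetCard.1 hR).2]; exact hr)],
      Finset.sum_const, Finset.card_powersetCard, Finset.card_range, nsmul_eq_mul, h0, tau,
      mul_assoc ((m + 1).choose r : ℝ), ENNReal.ofReal_mul (by positivity), ENNReal.ofReal_natCast]
    ring
  · simp only [if_neg (not_lt.2 hr)]
    have hsc := measurable_selfConv hg
    have hFr : Measurable fun x => F (x, r) := by fun_prop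
    simp only [← ENNReal.tsum_mul_right, Finset.sum_mul]
    rw [lintegral_tsum (fun m => by fun_prop)]
    refine tsum_congr fun m => ?_
    rw [lintegral_finsetSum _ (fun k _ => by fun_prop), ← Finset.mul_sum,
      sum_powersetCard_spread _ hr, Finset.mul_sum, Finset.mul_sum]
    refine Finset.sum_congr rfl fun k hk => ?_
    have hk0 : k ≠ 0 := by have := Finset.mem_Icc.1 hk; omega
    rw [tau_mul_upsilon hr hk, ENNReal.ofReal_mul (Nat.cast_nonneg _), ENNReal.ofReal_natCast]
    simp only [mul_assoc (_ * _ : ℝ≥0∞) (selfConv _ _ _) _]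
    rw [lintegral_const_mul _ (by fun_prop)]
    simp only [hφ, hw, convBase, if_neg hk0, nsmul_eq_mul]
    ring

theorem map_sampledSymbol (h : IsSession μ f g₀ p q M X B) (hg : Measurable g₀)
    (hq : q ∈ Set.Ioo (0 : ℝ) 1) (i : ℕ) :
    μ.map (fun ω => (sampledSymbol (fun j => X i j ω)
        (retained (fun j => B i j ω) (M i ω))).2)
      = (layered sampledBase).withDensity (fun e => sampledLikelihood p q g₀ (0, e)) := by
  refine Measure.ext_of_lintegral _ fun F hF => ?_
  rw [lintegral_map hF (measurable_sampledSymbol_session h i).snd,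
    lintegral_sampledSymbol h hg hq i hF]

end Session

/-! ### Consistency for the unsampled symbols -/

theorem lintegral_convBase_selfConv {g : ℝ → ℝ≥0∞} (hg : Measurable g) (k : ℕ) :
    ∫⁻ x, selfConv g k x ∂(convBase k) = (∫⁻ x, g x) ^ k := by
  match k with
  | 0 => simp [convBase, selfConv]
  | k + 1 =>
    rw [← lintegral_selfConv hg]
    simp [convBase]

/-- Densities on the half-line are determined by their self-convolutions. -/
theorem ae_eq_of_selfConv_ae_eq {g₁ g₂ : ℝ → ℝ≥0∞} (hm₁ : Measurable g₁) (hm₂ : Measurable g₂)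
    (hi₁ : ∫⁻ x, g₁ x ≠ ∞) (hi₂ : ∫⁻ x, g₂ x ≠ ∞)
    (hn₁ : ∀ x < 0, g₁ x = 0) (hn₂ : ∀ x < 0, g₂ x = 0) {k : ℕ}
    (h : selfConv g₁ (k + 1) =ᵐ[volume] selfConv g₂ (k + 1)) : g₁ =ᵐ[volume] g₂ := by
  refine ae_eq_of_laplace_eq hm₁ hm₂ hi₁ hi₂ hn₁ hn₂ fun n => ?_
  refine (ENNReal.pow_right_strictMono (Nat.succ_ne_zero k)).injective ?_
  simp only [Nat.succ_eq_add_one]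
  rw [← lintegral_exp_mul_selfConv hm₁, ← lintegral_exp_mul_selfConv hm₂]
  refine lintegral_congr_ae ?_
  filter_upwards [h] with x hx
  rw [hx]

/-- From `1 + y ≤ (1 + t) (1 + y / t)`. The scale `t` is free: it enters only through a logarithm,
while the part linear in `y` is divided by it. -/
theorem log_one_add_le_add_div {y t : ℝ} (hy : 0 ≤ y) (ht : 0 < t) :
    Real.log (1 + y) ≤ Real.log (1 + t) + y / t := by
  have hyt : 0 ≤ y / t := by positivity
  have h1 : Real.log (1 + y) ≤ Real.log ((1 + t) * (1 + y / t)) := by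
    refine Real.log_le_log (by linarith) ?_
    have : t * (y / t) = y := by field_simp
    nlinarith
  rw [Real.log_mul (by linarith) (by linarith)] at h1
  linarith [Real.log_le_sub_one_of_pos (x := 1 + y / t) (by linarith)]

theorem log_one_add_le_one_add {t : ℝ} (ht : 1 ≤ t) : Real.log (1 + t) ≤ 1 + Real.log t := by
  have h1 : Real.log (1 + t) ≤ Real.log (2 * t) := Real.log_le_log (by linarith) (by linarith)
  rw [Real.log_mul two_ne_zero (by linarith)] at h1
  linarith [Real.log_two_lt_d9]

/-- Scale `t = C ^ m`, with the crude bound `log C ≤ C`. In the application `C ^ m` is the mass of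
the `m`-fold convolution of the dominating function, so the last term has bounded expectation. -/
theorem ofReal_log_one_add_toReal_le {a C : ℝ≥0∞} (ha : a ≠ ∞) (hC : 1 ≤ C) (hC' : C ≠ ∞) (m : ℕ) :
    ENNReal.ofReal (Real.log (1 + a.toReal)) ≤ 1 + m * C + a / C ^ m := by
  lift a to NNReal using ha
  lift C to NNReal using hC'
  have hC1 : (1 : ℝ) ≤ C := by exact_mod_cast hC
  have hCm : (1 : ℝ) ≤ (C : ℝ) ^ m := one_le_pow₀ hC1
  have h1 := log_one_add_le_add_div a.2 (t := (C : ℝ) ^ m) (by linarith)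
  have h2 := log_one_add_le_one_add hCm
  rw [Real.log_pow] at h2
  have h3 : (m : ℝ) * Real.log C ≤ m * C :=
    mul_le_mul_of_nonneg_left (Real.log_le_self C.2) (Nat.cast_nonneg m)
  have hC0 : (C ^ m : NNReal) ≠ 0 := by
    have : (0 : ℝ) < (C : ℝ) ^ m := by linarith
    exact_mod_cast this.ne'
  have hrhs : (1 + m * C + a / C ^ m : ℝ≥0∞) = ((1 + m * C + a / C ^ m : NNReal) : ℝ≥0∞) := by
    push_cast [ENNReal.coe_div hC0]
    rfl
  rw [hrhs, ENNReal.coe_toReal, ENNReal.ofReal_le_iff_le_toReal ENNReal.coe_ne_top,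
    ENNReal.coe_toReal]
  push_cast
  have h4 : Real.log (1 + a.1) ≤ Real.log (1 + (C : ℝ) ^ m) + a.1 / (C : ℝ) ^ m := h1
  change Real.log (1 + a.1) ≤ 1 + m * (C : ℝ) + a.1 / (C : ℝ) ^ m
  linarith

theorem ae_convBase_of_layered {s : ℝ × ℕ → Prop}
    (h : ∀ m, ∀ᵐ x ∂(convBase m), s (x, m + 1)) : ∀ᵐ e ∂(layered symbolBase), s e := by
  refine ae_layered_iff.2 fun r => ?_
  match r with
  | 0 => simp [symbolBase]
  | m + 1 => simpa [symbolBase] using h m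

theorem lintegral_layered_symbolBase {F : ℝ × ℕ → ℝ≥0∞} (hF : Measurable F) :
    ∫⁻ e, F e ∂(layered symbolBase) = ∑' m, ∫⁻ x, F (x, m + 1) ∂(convBase m) := by
  rw [lintegral_layered _ hF]
  refine (tsum_eq_zero_add' ENNReal.summable).trans ?_
  simp [symbolBase]

/-- The mean flow size is finite if the flow sizes are bounded. -/
theorem tsum_mul_ne_top_of_bounded {p : PMF ℕ} (h : ¬ ∀ b : ℕ, ∃ m, b < m ∧ p m ≠ 0) :
    ∑' m : ℕ, (m : ℝ≥0∞) * p m ≠ ∞ := by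
  push Not at h
  obtain ⟨b, hb⟩ := h
  rw [tsum_eq_sum (s := Finset.range (b + 1)) fun m hm => by
    rw [hb m (by simpa using hm), mul_zero]]
  exact ENNReal.sum_ne_top.2 fun m _ => ENNReal.mul_ne_top (ENNReal.natCast_ne_top m) (p.apply_ne_top m)

theorem sum_log_le_sum_log_of_isMaxOn {P : Type*} {L : P → ℝ × ℝ × ℕ → ℝ≥0∞}
    {s : ℕ → ℝ × ℝ × ℕ} {n : ℕ} {K : Set P} {θ θ₀ : P} (hθ₀ : θ₀ ∈ K)
    (h : IsMaxOn (fun θ => avgLogLik (L θ) s n) K θ) :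
    ∑ i ∈ Finset.range n, Real.log (L θ₀ (s i)).toReal ≤
      ∑ i ∈ Finset.range n, Real.log (L θ (s i)).toReal := by
  rcases Nat.eq_zero_or_pos n with rfl | hn
  · simp
  · exact le_of_mul_le_mul_left (h hθ₀) (inv_pos.2 (Nat.cast_pos.2 hn))

theorem tendstoInMeasure_symbol {Ω P : Type*} [MeasurableSpace Ω] [MetricSpace P]
    {μ : Measure Ω} [IsProbabilityMeasure μ] {g : P → ℝ → ℝ≥0∞} {K : Set P} {θ₀ : P}
    (hK : IsCompact K) (hθ₀ : θ₀ ∈ K) (hreg : IsRegular g K) (hid : Identifiable g K)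
    {f : ℝ → ℝ≥0∞} (hf : Measurable f) {p : PMF ℕ} (hp : ∃ m, 1 ≤ m ∧ p m ≠ 0)
    (hmean : ∑' m : ℕ, (m : ℝ≥0∞) * p m ≠ ∞) {q : ℝ}
    {M : ℕ → Ω → ℕ} {X : ℕ → ℕ → Ω → ℝ} {B : ℕ → ℕ → Ω → Bool}
    (hdata : IsSession μ f (g θ₀) p q M X B) {θhat : ℕ → Ω → P}
    (hhat : IsMLE μ (fun θ => likelihood f p (g θ))
      (fun i ω => symbol (fun j => X i j ω) (M i ω)) K θhat) :
    TendstoInMeasure μ θhat atTop fun _ => θ₀ := by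
  obtain ⟨h, hh, hhi, hgh⟩ := hreg.exists_dominating hK
  have hg0 := hreg.measurable θ₀ hθ₀
  have hL : ∀ θ ∈ K, Measurable (durationLikelihood p (g θ)) := fun θ hθ =>
    measurable_durationLikelihood p (hreg.measurable θ hθ)
  have hsc : ∀ k, Measurable (selfConv (g θ₀) k) := measurable_selfConv hg0
  have hsch : ∀ k, Measurable (selfConv h k) := measurable_selfConv hh
  have hC : 1 ≤ ∫⁻ x, h x := by
    rw [← hreg.lintegral_eq_one θ₀ hθ₀]
    exact lintegral_mono_ae (hgh.mono fun x hx => hx θ₀ hθ₀)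
  set C := ∫⁻ x, h x with hCdef
  have hCm : ∀ m, C ^ m ≠ 0 := fun m => pow_ne_zero _ (zero_lt_one.trans_le hC).ne'
  have hCm' : ∀ m, C ^ m ≠ ∞ := fun m => ENNReal.pow_ne_top hhi
  have hfin : ∀ᵐ e ∂(layered symbolBase), ∀ θ ∈ K, durationLikelihood p (g θ) e < ∞ := by
    refine ae_convBase_of_layered fun m => ?_
    filter_upwards [ae_selfConv_le hgh m, ae_selfConv_lt_top hh hhi m] with x h1 h2 θ hθ
    exact ENNReal.mul_lt_top ((h1 θ hθ).trans_lt h2) (p.apply_lt_top m)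
  have hzero : ∀ᵐ e ∂(layered symbolBase), ∀ θ ∈ K,
      durationLikelihood p (g θ) e = 0 ↔ durationLikelihood p (g θ₀) e = 0 := by
    refine ae_convBase_of_layered fun m => ?_
    filter_upwards [ae_selfConv_eq_zero_iff hreg.measurable hreg.common_support m] with x h1 θ hθ
    simp [durationLikelihood, h1 θ hθ θ₀ hθ₀]
  refine tendstoInMeasure_of_likelihood (ρ := layered symbolBase)
    (L := fun θ => durationLikelihood p (g θ))
    (G := fun e => 1 + ((e.2 - 1 : ℕ) : ℝ≥0∞) * C +
      (selfConv h (e.2 - 1) e.1 / selfConv (g θ₀) (e.2 - 1) e.1) / C ^ (e.2 - 1))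
    hK hθ₀ hL ?_ hfin hzero ?_ ?_ ?_ ?_
    (fun i => (measurable_symbol hdata i).snd) (map_symbol hdata hg0) ?_ ?_
  · intro θ hθ
    rw [lintegral_layered_symbolBase (hL θ hθ)]
    simp only [durationLikelihood, Nat.add_sub_cancel]
    have hmt := measurable_selfConv (hreg.measurable θ hθ)
    simp only [lintegral_mul_const _ (hmt _), lintegral_convBase_selfConv (hreg.measurable θ hθ),
      hreg.lintegral_eq_one θ hθ, one_pow, one_mul, p.tsum_coe, le_refl]
  · refine ae_convBase_of_layered fun m => ?_
    filter_upwards [ae_continuousOn_selfConv hreg.measurable hh hhi hgh hreg.continuousOn m]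
      with x hx θ hθ
    exact ENNReal.Tendsto.mul_const (hx θ hθ) (.inr (p.apply_ne_top m))
  · intro θ hθ heq
    obtain ⟨m, hm1, hpm⟩ := hp
    obtain ⟨k, rfl⟩ : ∃ k, m = k + 1 := ⟨m - 1, by omega⟩
    refine hid θ hθ θ₀ hθ₀ (ae_eq_of_selfConv_ae_eq (k := k) (hreg.measurable θ hθ) hg0
      (by simp [hreg.lintegral_eq_one θ hθ]) (by simp [hreg.lintegral_eq_one θ₀ hθ₀])
      (hreg.eq_zero_of_neg θ hθ) (hreg.eq_zero_of_neg θ₀ hθ₀) ?_)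
    -- Layer `k + 2` holds the flows with `m = k + 1` inter-renewals, whose probability is positive,
    -- so the factor `p m` can be cancelled.
    have := ae_layered_iff.1 heq (k + 2)
    simp only [symbolBase, convBase, Nat.add_eq_zero_iff, one_ne_zero, OfNat.ofNat_ne_zero,
      and_false, if_false, durationLikelihood, Nat.add_succ_sub_one] at this
    filter_upwards [this] with x hx
    exact (ENNReal.mul_left_inj hpm (p.apply_ne_top _)).1 hx
  · have hGm : Measurable fun e : ℝ × ℕ => 1 + ((e.2 - 1 : ℕ) : ℝ≥0∞) * C +
        (selfConv h (e.2 - 1) e.1 / selfConv (g θ₀) (e.2 - 1) e.1) / C ^ (e.2 - 1) :=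
      measurable_from_prod_countable_left fun r => by dsimp only; fun_prop
    rw [lintegral_withDensity_eq_lintegral_mul _ (hL θ₀ hθ₀) hGm,
      lintegral_layered_symbolBase ((hL θ₀ hθ₀).mul hGm)]
    -- Multiplying by the density cancels the denominator `selfConv (g θ₀) m`, and the mass `C ^ m`
    -- of `selfConv h m` cancels its normalisation. Each layer contributes `p m (1 + m C) + p m`.
    have hle : ∀ m, ∫⁻ x, (durationLikelihood p (g θ₀) * fun e : ℝ × ℕ =>
        1 + ((e.2 - 1 : ℕ) : ℝ≥0∞) * C +
        (selfConv h (e.2 - 1) e.1 / selfConv (g θ₀) (e.2 - 1) e.1) / C ^ (e.2 - 1)) (x, m + 1)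
          ∂(convBase m) ≤ 2 * p m + C * (m * p m) := by
      intro m
      simp only [Pi.mul_apply, durationLikelihood, Nat.add_sub_cancel]
      calc _ ≤ ∫⁻ x, (p m * (1 + m * C)) * selfConv (g θ₀) m x
              + (p m * (C ^ m)⁻¹) * selfConv h m x ∂(convBase m) := by
            refine lintegral_mono fun x => ?_
            have h1 : selfConv (g θ₀) m x * (selfConv h m x / selfConv (g θ₀) m x) ≤ selfConv h m x :=
              ENNReal.mul_div_le
            calc _ = (p m * (1 + m * C)) * selfConv (g θ₀) m x + (p m * (C ^ m)⁻¹) *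
                  (selfConv (g θ₀) m x * (selfConv h m x / selfConv (g θ₀) m x)) := by
                  rw [div_eq_mul_inv _ (C ^ m)]; ring
              _ ≤ _ := by gcongr
        _ = p m * (1 + m * C) + p m * ((C ^ m)⁻¹ * C ^ m) := by
            rw [lintegral_add_left (by fun_prop), lintegral_const_mul _ (hsc m),
              lintegral_const_mul _ (hsch m), lintegral_convBase_selfConv hg0,
              lintegral_convBase_selfConv hh, hreg.lintegral_eq_one θ₀ hθ₀, one_pow, mul_one,
              mul_assoc]
        _ = _ := by
            rw [ENNReal.inv_mul_cancel (hCm m) (hCm' m)]; ring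
    refine ne_top_of_le_ne_top ?_ (ENNReal.tsum_le_tsum hle)
    rw [ENNReal.tsum_add, ENNReal.tsum_mul_left, ENNReal.tsum_mul_left, p.tsum_coe]
    exact ENNReal.add_ne_top.2 ⟨by simp, ENNReal.mul_ne_top hhi hmean⟩
  · refine ae_convBase_of_layered fun m => ?_
    filter_upwards [ae_selfConv_le hgh m, ae_selfConv_lt_top hh hhi m] with x h1 h2 h0 θ hθ
    simp only [durationLikelihood, Nat.add_sub_cancel] at h0 ⊢
    have h0' := mul_ne_zero_iff.1 h0
    rw [ENNReal.mul_div_mul_right _ _ h0'.2 (p.apply_ne_top m)]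
    refine (ofReal_log_one_add_toReal_le (ENNReal.div_ne_top ((h1 θ hθ).trans_lt h2).ne h0'.1)
      hC hhi m).trans ?_
    gcongr
    exact h1 θ hθ
  · intro i j hij
    have hm : Measurable fun z : ℕ × (ℕ → ℝ) × (ℕ → Bool) => (symbol z.2.1 z.1).2 := by
      refine measurable_from_prod_countable_right fun m => ?_
      simp only [symbol]
      fun_prop
    exact (hdata.indep_flow.indepFun hij).comp hm hm
  · have hgood : ∀ᵐ ω ∂μ, ∀ i, (∀ θ ∈ K,
        durationLikelihood p (g θ) (symbol (fun j => X i j ω) (M i ω)).2 ≠ 0 ∧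
        durationLikelihood p (g θ) (symbol (fun j => X i j ω) (M i ω)).2 ≠ ∞) := by
      refine ae_all_iff.2 fun i => ae_of_ae_map
        (p := fun e => ∀ θ ∈ K, durationLikelihood p (g θ) e ≠ 0 ∧ durationLikelihood p (g θ) e ≠ ∞)
        (measurable_symbol hdata i).snd.aemeasurable ?_
      rw [map_symbol hdata hg0 i, ae_withDensity_iff (hL θ₀ hθ₀)]
      filter_upwards [hfin, hzero] with e h1 h2 h0 θ hθ
      exact ⟨fun h => h0 ((h2 θ hθ).1 h), (h1 θ hθ).ne⟩
    have hfi : ∫⁻ x, f x ≠ ∞ := by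
      have h1 := congrArg (fun ν => ν Set.univ) (hdata.law_first 0).map_eq
      simp only [Measure.map_apply (hdata.measurable_time 0 0) MeasurableSet.univ, Set.preimage_univ,
        measure_univ, withDensity_apply _ MeasurableSet.univ, Measure.restrict_univ] at h1
      rw [← h1]
      exact ENNReal.one_ne_top
    have hfgood : ∀ᵐ ω ∂μ, ∀ i, f (X i 0 ω) ≠ 0 ∧ f (X i 0 ω) ≠ ∞ := by
      refine ae_all_iff.2 fun i => ae_of_ae_map (p := fun x => f x ≠ 0 ∧ f x ≠ ∞)
        (hdata.measurable_time i 0).aemeasurable ?_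
      rw [(hdata.law_first i).map_eq, ae_withDensity_iff hf]
      filter_upwards [ae_lt_top hf hfi] with x hx h0
      exact ⟨h0, hx.ne⟩
    intro n
    filter_upwards [hgood, hfgood, hhat n] with ω h1 h2 h3
    refine ⟨h3.1, ?_⟩
    -- The factor `f` is positive and finite along the data, so its logarithm splits off as a term
    -- free of `θ` and drops out of the comparison.
    have key : ∀ θ ∈ K, ∀ i, Real.log (likelihood f p (g θ) (symbol (fun j => X i j ω) (M i ω))).toReal
        = Real.log (f (X i 0 ω)).toReal + Real.log
          (durationLikelihood p (g θ) (symbol (fun j => X i j ω) (M i ω)).2).toReal := by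
      intro θ hθ i
      rw [← Real.log_mul (ENNReal.toReal_pos (h2 i).1 (h2 i).2).ne'
        (ENNReal.toReal_pos (h1 i θ hθ).1 (h1 i θ hθ).2).ne', ← ENNReal.toReal_mul]
      simp only [likelihood, durationLikelihood, mul_assoc]
      rfl
    have := sum_log_le_sum_log_of_isMaxOn hθ₀ h3.2
    rw [Finset.sum_congr rfl fun i _ => key θ₀ hθ₀ i, Finset.sum_congr rfl fun i _ => key _ h3.1 i,
      Finset.sum_add_distrib, Finset.sum_add_distrib] at this
    linarith

/-! ### The series of weighted self-convolutions -/

theorem sum_Icc_one_eq_sum_range {A : Type*} [AddCommMonoid A] (φ : ℕ → A) (N : ℕ) :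
    ∑ k ∈ Finset.Icc 1 N, φ k = ∑ k ∈ Finset.range N, φ (k + 1) := by
  rw [Finset.range_eq_Ico, Finset.sum_Ico_add' φ 0 N 1]
  rfl

section Xi

variable {p : PMF ℕ} {q : ℝ}

/-- The two orders of summation agree by nonnegativity. The additional terms `1 ≤ k < r - 1` of `xi`
vanish since `(k - 1).choose (r - 2) = 0`. -/
theorem xi_eq_sampledLikelihood (g : ℝ → ℝ≥0∞) {r : ℕ} (hr : 2 ≤ r) (x : ℝ) :
    sampledLikelihood p q g (0, x, r) = xi p q g r x := by
  simp only [sampledLikelihood, if_neg (not_lt.2 hr), xi, xiCoeff, ← ENNReal.tsum_mul_right]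
  rw [ENNReal.tsum_comm]
  refine tsum_congr fun m => ?_
  rw [tsum_eq_sum (s := Finset.range m) fun k hk => by
    rw [if_neg (by simpa using hk), zero_mul], Finset.sum_subset
      (Finset.Icc_subset_Icc_left (by omega : 1 ≤ r - 1)) (fun k hk hk' => ?_),
    sum_Icc_one_eq_sum_range]
  · refine Finset.sum_congr rfl fun k hk => ?_
    rw [if_pos (by have := Finset.mem_range.1 hk; omega)]
  · rw [Finset.mem_Icc] at hk hk'
    rw [upsilon, Nat.choose_eq_zero_of_lt (by omega : k - 1 < r - 2)]
    simp

theorem xiPartial_eq_sum_range (g : ℝ → ℝ≥0∞) (r N : ℕ) (x : ℝ) :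
    xiPartial p q g r N x = ∑ k ∈ Finset.range N, xiCoeff p q r (k + 1) * selfConv g (k + 1) x := by
  rw [xiPartial, sum_Icc_one_eq_sum_range]

theorem tendsto_xiPartial (g : ℝ → ℝ≥0∞) (r : ℕ) (x : ℝ) :
    Tendsto (fun N => xiPartial p q g r N x) atTop (𝓝 (xi p q g r x)) := by
  simp only [xiPartial_eq_sum_range]
  exact ENNReal.tendsto_nat_tsum _

theorem xiPartial_le_xi (g : ℝ → ℝ≥0∞) (r N : ℕ) (x : ℝ) :
    xiPartial p q g r N x ≤ xi p q g r x := by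
  rw [xiPartial_eq_sum_range]
  exact ENNReal.sum_le_tsum _

theorem measurable_xiPartial {g : ℝ → ℝ≥0∞} (hg : Measurable g) (r N : ℕ) :
    Measurable (xiPartial p q g r N) := by
  have := measurable_selfConv hg
  unfold xiPartial
  fun_prop

theorem xi_eq_xiPartial_of_bounded {b : ℕ} (hb : ∀ m, b < m → p m = 0) (g : ℝ → ℝ≥0∞) (r : ℕ)
    {N : ℕ} (hN : b ≤ N) (x : ℝ) : xi p q g r x = xiPartial p q g r N x := by
  rw [xiPartial_eq_sum_range, xi, tsum_eq_sum fun k hk => ?_]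
  rw [Finset.mem_range, not_lt] at hk
  have : xiCoeff p q r (k + 1) = 0 := by
    rw [xiCoeff, ENNReal.tsum_eq_zero]
    intro m
    split_ifs with h
    · rw [hb m (by omega), zero_mul]
    · rfl
  rw [this, zero_mul]

theorem xiConvergesUniformly_of_bounded {P : Type*} {b : ℕ} (hb : ∀ m, b < m → p m = 0)
    (g : P → ℝ → ℝ≥0∞) (K : Set P) : XiConvergesUniformly p q g K := by
  refine Metric.tendstoUniformlyOn_iff.2 fun ε hε => ?_
  filter_upwards [eventually_ge_atTop b] with N hN z _
  rwa [xi_eq_xiPartial_of_bounded hb _ _ hN, dist_self]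

/-- If the partial sums are finite, uniform convergence of their real values forces finiteness. -/
theorem xi_ne_top_of_tendsto {g : ℝ → ℝ≥0∞} {r : ℕ} {x : ℝ}
    (hfin : ∀ N, xiPartial p q g r N x ≠ ∞)
    (h : Tendsto (fun N => (xiPartial p q g r N x).toReal) atTop (𝓝 (xi p q g r x).toReal)) :
    xi p q g r x ≠ ∞ := by
  intro htop
  -- Were `xi` infinite, its `toReal` would be the default value `0`, and the partial sums would
  -- tend both to `0` and to `∞`.
  have h1 := (ENNReal.continuous_ofReal.tendsto _).comp h
  have h2 := tendsto_nhds_unique h1 ((tendsto_xiPartial g r x).congr fun N =>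
    (ENNReal.ofReal_toReal (hfin N)).symm)
  rw [htop] at h2
  simp at h2

theorem lintegral_layered_sampledBase {F : ℝ × ℕ → ℝ≥0∞} (hF : Measurable F) :
    ∫⁻ e, F e ∂(layered sampledBase) = F (0, 0) + (F (0, 1) + ∑' r, ∫⁻ x, F (x, r + 2)) := by
  rw [lintegral_layered _ hF]
  refine (tsum_eq_zero_add' ENNReal.summable).trans ?_
  rw [tsum_eq_zero_add' ENNReal.summable]
  simp [sampledBase]

theorem ae_sampledBase_of_layered {s : ℝ × ℕ → Prop} (h0 : ∀ r < 2, s (0, r))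
    (h : ∀ r, 2 ≤ r → ∀ᵐ x : ℝ, s (x, r)) : ∀ᵐ e ∂(layered sampledBase), s e := by
  refine ae_layered_iff.2 fun r => ?_
  rcases lt_or_ge r 2 with hr | hr
  · simp only [sampledBase, if_pos hr]
    rw [ae_dirac_eq]
    exact h0 r hr
  · simpa [sampledBase, not_lt.2 hr] using h r hr

theorem lintegral_sampledLikelihood {g : ℝ → ℝ≥0∞} (hg : Measurable g) (hg1 : ∫⁻ x, g x = 1) :
    ∫⁻ e, sampledLikelihood p q g (0, e) ∂(layered sampledBase)
      = ∑' m : ℕ, p m * ENNReal.ofReal (tau q m 0) + (∑' m : ℕ, p m * ENNReal.ofReal (tau q m 1)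
        + ∑' r, ∑' k, xiCoeff p q (r + 2) (k + 1)) := by
  rw [lintegral_layered_sampledBase (measurable_sampledLikelihood p q hg)]
  simp only [xi_eq_sampledLikelihood g (Nat.le_add_left 2 _)]
  congr 2
  refine tsum_congr fun r => ?_
  have := measurable_selfConv hg
  unfold xi
  rw [lintegral_tsum fun k => by fun_prop]
  refine tsum_congr fun k => ?_
  rw [lintegral_const_mul _ (this _), lintegral_selfConv hg, hg1, one_pow, mul_one]

theorem lintegral_xiPartial_le {h : ℝ → ℝ≥0∞} (hh : Measurable h) (hC : 1 ≤ ∫⁻ x, h x) (r N : ℕ) :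
    ∫⁻ x, xiPartial p q h r N x ≤ (∫⁻ x, h x) ^ N * ∑' k, xiCoeff p q r (k + 1) := by
  have := measurable_selfConv hh
  simp only [xiPartial_eq_sum_range]
  rw [lintegral_finsetSum _ fun k _ => by fun_prop, ← ENNReal.tsum_mul_left]
  refine le_trans (Finset.sum_le_sum fun k hk => ?_) (ENNReal.sum_le_tsum (Finset.range N))
  rw [lintegral_const_mul _ (this _), lintegral_selfConv hh, mul_comm]
  gcongr
  exact Finset.mem_range.1 hk

theorem exp_mul_xi {g : ℝ → ℝ≥0∞} (hg : Measurable g) (t : ℝ) (r : ℕ) :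
    ∫⁻ x, ENNReal.ofReal (Real.exp (-t * x)) * xi p q g r x = ∑' k, xiCoeff p q r (k + 1) *
      (∫⁻ x, ENNReal.ofReal (Real.exp (-t * x)) * g x) ^ (k + 1) := by
  have := measurable_selfConv hg
  unfold xi
  simp only [← ENNReal.tsum_mul_left]
  rw [lintegral_tsum fun k => by fun_prop]
  refine tsum_congr fun k => ?_
  rw [← lintegral_exp_mul_selfConv hg, ← lintegral_const_mul _ (by fun_prop)]
  exact lintegral_congr fun x => by ring

/-- Retaining exactly the first and the last packet of a flow of size `m + 1` has positive
probability and gives `r = 2`, `k = m`. -/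
theorem exists_xiCoeff_two_ne_zero (hp : ∃ m, 1 ≤ m ∧ p m ≠ 0) (hq : q ∈ Set.Ioo (0 : ℝ) 1) :
    ∃ k, xiCoeff p q 2 (k + 1) ≠ 0 := by
  obtain ⟨m, hm, hpm⟩ := hp
  refine ⟨m - 1, fun h => ?_⟩
  rw [xiCoeff, ENNReal.tsum_eq_zero] at h
  have hmm := h m
  rw [Nat.sub_add_cancel hm, if_pos le_rfl, tau_mul_upsilon le_rfl
    (Finset.mem_Icc.2 ⟨by omega, le_rfl⟩), mul_eq_zero, ENNReal.ofReal_eq_zero] at hmm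
  refine hmm.elim hpm fun h => absurd h (not_le.2 ?_)
  have h1 : 0 < (m + 1 - m) * (m - 1).choose (2 - 2) := by simp
  have h2 : (0 : ℝ) < 1 - q := sub_pos.2 hq.2
  have h3 := hq.1
  have h4 : (0 : ℝ) < ((m + 1 - m) * (m - 1).choose (2 - 2) : ℕ) := by exact_mod_cast h1
  positivity

/-- Densities on the half-line are determined by the series `ξ`. -/
theorem ae_eq_of_xi_ae_eq {g₁ g₂ : ℝ → ℝ≥0∞} (hm₁ : Measurable g₁) (hm₂ : Measurable g₂)
    (hi₁ : ∫⁻ x, g₁ x = 1) (hi₂ : ∫⁻ x, g₂ x = 1)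
    (hn₁ : ∀ x < 0, g₁ x = 0) (hn₂ : ∀ x < 0, g₂ x = 0) {r : ℕ}
    (hc : ∃ k, xiCoeff p q r (k + 1) ≠ 0) (hs : ∑' k, xiCoeff p q r (k + 1) ≠ ∞)
    (h : xi p q g₁ r =ᵐ[volume] xi p q g₂ r) : g₁ =ᵐ[volume] g₂ := by
  have hle1 : ∀ g : ℝ → ℝ≥0∞, (∫⁻ x, g x = 1) → (∀ x < 0, g x = 0) → ∀ n : ℕ,
      ∫⁻ x, ENNReal.ofReal (Real.exp (-(n : ℝ) * x)) * g x ≤ 1 := by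
    intro g hi hn n
    rw [← hi]
    refine lintegral_mono fun x => ?_
    rcases lt_or_ge x 0 with hx | hx
    · simp [hn x hx]
    · refine mul_le_of_le_one_left' (ENNReal.ofReal_le_one.2 (Real.exp_le_one_iff.2 ?_))
      have : (0 : ℝ) ≤ n * x := by positivity
      linarith
  -- A power series with nonnegative coefficients, one of them positive, is strictly increasing.
  -- Strictness needs a finite value at the smaller argument, which `a ≤ 1` and summability of the
  -- coefficients provide.
  have hlt : ∀ a b : ℝ≥0∞, a ≤ 1 → a < b →
      ∑' k, xiCoeff p q r (k + 1) * a ^ (k + 1) < ∑' k, xiCoeff p q r (k + 1) * b ^ (k + 1) := by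
    intro a b ha hab
    obtain ⟨k, hk⟩ := hc
    refine ENNReal.tsum_lt_tsum (i := k) (ne_top_of_le_ne_top hs (ENNReal.tsum_le_tsum fun k =>
      mul_le_of_le_one_right' (pow_le_one₀ zero_le ha))) (fun k => by gcongr) ?_
    exact ENNReal.mul_lt_mul_right hk (ENNReal.ne_top_of_tsum_ne_top hs k)
      (ENNReal.pow_right_strictMono (Nat.succ_ne_zero k) hab)
  refine ae_eq_of_laplace_eq hm₁ hm₂ (by simp [hi₁]) (by simp [hi₂]) hn₁ hn₂ fun n => ?_
  have heq : ∫⁻ x, ENNReal.ofReal (Real.exp (-(n : ℝ) * x)) * xi p q g₁ r x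
      = ∫⁻ x, ENNReal.ofReal (Real.exp (-(n : ℝ) * x)) * xi p q g₂ r x :=
    lintegral_congr_ae (h.mono fun x hx => by dsimp only; rw [hx])
  rw [exp_mul_xi hm₁, exp_mul_xi hm₂] at heq
  rcases lt_trichotomy (∫⁻ x, ENNReal.ofReal (Real.exp (-(n : ℝ) * x)) * g₁ x)
    (∫⁻ x, ENNReal.ofReal (Real.exp (-(n : ℝ) * x)) * g₂ x) with hl | hl | hl
  · exact absurd heq (hlt _ _ (hle1 g₁ hi₁ hn₁ n) hl).ne
  · exact hl
  · exact absurd heq (hlt _ _ (hle1 g₂ hi₂ hn₂ n) hl).ne'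

/-- Uniform convergence transfers finiteness and continuity in `θ` from the partial sums to `xi`. It
is assumed only for `x > 0`; for `x < 0` every convolution vanishes, and `0` is a null set. -/
theorem ae_xi_regular {P : Type*} [PseudoMetricSpace P] {g : P → ℝ → ℝ≥0∞} {K : Set P}
    (hreg : IsRegular g K) {h : ℝ → ℝ≥0∞} (hh : Measurable h) (hhi : ∫⁻ x, h x ≠ ∞)
    (hgh : ∀ᵐ x : ℝ, ∀ θ ∈ K, g θ x ≤ h x) (hunif : XiConvergesUniformly p q g K)
    {r : ℕ} (hr : 2 ≤ r) (hcoef : ∀ k, xiCoeff p q r (k + 1) ≠ ∞) :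
    ∀ᵐ x : ℝ, (∀ θ ∈ K, xi p q (g θ) r x ≠ ∞) ∧
      (∀ θ ∈ K, ∀ N, xiPartial p q (g θ) r N x ≤ xiPartial p q h r N x) ∧
      (∀ N, xiPartial p q h r N x ≠ ∞) ∧
      (∀ θ ∈ K, ∀ θ' ∈ K, xi p q (g θ) r x = 0 ↔ xi p q (g θ') r x = 0) ∧
      ContinuousOn (fun θ => xi p q (g θ) r x) K ∧
      (0 < x ∨ ∀ θ ∈ K, xi p q (g θ) r x = 0) := by
  have hbase : ∀ k, convBase (k + 1) = volume := fun k => by simp [convBase]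
  have h1 := ae_all_iff.2 fun k => (hbase k) ▸ ae_selfConv_le hgh (k + 1)
  have h2 := ae_all_iff.2 fun k => (hbase k) ▸ ae_selfConv_lt_top hh hhi (k + 1)
  have h3 := ae_all_iff.2 fun k => (hbase k) ▸
    ae_selfConv_eq_zero_iff hreg.measurable hreg.common_support (k + 1)
  have h4 := ae_all_iff.2 fun k => (hbase k) ▸
    ae_continuousOn_selfConv hreg.measurable hh hhi hgh hreg.continuousOn (k + 1)
  filter_upwards [h1, h2, h3, h4, compl_mem_ae_iff.2 (measure_singleton (0 : ℝ))]
    with x h1 h2 h3 h4 hx0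
  have hle : ∀ θ ∈ K, ∀ N, xiPartial p q (g θ) r N x ≤ xiPartial p q h r N x := by
    intro θ hθ N
    simp only [xiPartial_eq_sum_range]
    exact Finset.sum_le_sum fun k _ => mul_le_mul_right (h1 k θ hθ) _
  have hfin : ∀ N, xiPartial p q h r N x ≠ ∞ := by
    intro N
    rw [xiPartial_eq_sum_range]
    exact ENNReal.sum_ne_top.2 fun k _ => ENNReal.mul_ne_top (hcoef k) (h2 k).ne
  have hzero : ∀ θ ∈ K, ∀ θ' ∈ K, xi p q (g θ) r x = 0 ↔ xi p q (g θ') r x = 0 := by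
    intro θ hθ θ' hθ'
    simp only [xi, ENNReal.tsum_eq_zero, mul_eq_zero, h3 _ θ hθ θ' hθ']
  rcases lt_or_gt_of_ne hx0 with hx | hx
  · have h0 : ∀ θ ∈ K, xi p q (g θ) r x = 0 := fun θ hθ => by
      simp only [xi, ENNReal.tsum_eq_zero, mul_eq_zero]
      exact fun k => .inr (selfConv_eq_zero_of_neg (hreg.eq_zero_of_neg θ hθ) _ x hx)
    exact ⟨fun θ hθ => by simp [h0 θ hθ], hle, hfin, hzero, continuousOn_const.congr h0, .inr h0⟩
  · have hfinθ : ∀ θ ∈ K, ∀ N, xiPartial p q (g θ) r N x ≠ ∞ := fun θ hθ N =>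
      ne_top_of_le_ne_top (hfin N) (hle θ hθ N)
    have hu : TendstoUniformlyOn (fun N θ => (xiPartial p q (g θ) r N x).toReal)
        (fun θ => (xi p q (g θ) r x).toReal) atTop K := by
      rw [Metric.tendstoUniformlyOn_iff]
      intro ε hε
      filter_upwards [Metric.tendstoUniformlyOn_iff.1 hunif ε hε] with N hN θ hθ
      exact hN (r, x, θ) ⟨hr, hx, hθ⟩
    have hxi : ∀ θ ∈ K, xi p q (g θ) r x ≠ ∞ := fun θ hθ =>
      xi_ne_top_of_tendsto (hfinθ θ hθ) (hu.tendsto_at hθ)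
    refine ⟨hxi, hle, hfin, hzero, ?_, .inl hx⟩
    have hcp : ∀ N, ContinuousOn (fun θ => (xiPartial p q (g θ) r N x).toReal) K := by
      intro N θ hθ
      refine (ENNReal.tendsto_toReal (hfinθ θ hθ N)).comp ?_
      simp only [xiPartial_eq_sum_range]
      exact tendsto_finsetSum _ fun k _ => ENNReal.Tendsto.const_mul (h4 k θ hθ) (.inr (hcoef k))
    have hc := hu.continuousOn (.of_forall hcp)
    exact (ENNReal.continuous_ofReal.comp_continuousOn hc).congr fun θ hθ =>
      (ENNReal.ofReal_toReal (hxi θ hθ)).symm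

end Xi

/-! ### Consistency for the sampled symbols -/

section Mass

variable {Ω : Type*} [MeasurableSpace Ω] {μ : Measure Ω} [IsProbabilityMeasure μ]
  {f g₀ : ℝ → ℝ≥0∞} {p : PMF ℕ} {q : ℝ} {M : ℕ → Ω → ℕ} {X : ℕ → ℕ → Ω → ℝ} {B : ℕ → ℕ → Ω → Bool}

theorem lintegral_sampledLikelihood_eq_one (hdata : IsSession μ f g₀ p q M X B)
    (hg : Measurable g₀) (hq : q ∈ Set.Ioo (0 : ℝ) 1) :
    ∫⁻ e, sampledLikelihood p q g₀ (0, e) ∂(layered sampledBase) = 1 := by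
  have := congrArg (fun ν => ν Set.univ) (map_sampledSymbol hdata hg hq 0)
  simp only [withDensity_apply _ MeasurableSet.univ, Measure.restrict_univ] at this
  rw [← this, Measure.map_apply (measurable_sampledSymbol_session hdata 0).snd
    MeasurableSet.univ, Set.preimage_univ, measure_univ]

/-- The left side is the total mass of the sampled likelihood, which is `1` because that likelihood
is the density of a law. As no density appears in it, it also gives the mass at every other
parameter and the summability of the coefficients. -/
theorem tsum_sampled_mass (hdata : IsSession μ f g₀ p q M X B) (hg : Measurable g₀)
    (hg1 : ∫⁻ x, g₀ x = 1) (hq : q ∈ Set.Ioo (0 : ℝ) 1) :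
    ∑' m : ℕ, p m * ENNReal.ofReal (tau q m 0) + (∑' m : ℕ, p m * ENNReal.ofReal (tau q m 1)
      + ∑' r, ∑' k, xiCoeff p q (r + 2) (k + 1)) = 1 := by
  rw [← lintegral_sampledLikelihood hg hg1, lintegral_sampledLikelihood_eq_one hdata hg hq]

theorem tsum_tsum_xiCoeff_ne_top (hdata : IsSession μ f g₀ p q M X B) (hg : Measurable g₀)
    (hg1 : ∫⁻ x, g₀ x = 1) (hq : q ∈ Set.Ioo (0 : ℝ) 1) :
    ∑' r, ∑' k, xiCoeff p q (r + 2) (k + 1) ≠ ∞ :=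
  ne_top_of_le_ne_top ENNReal.one_ne_top
    ((le_add_self.trans le_add_self).trans (tsum_sampled_mass hdata hg hg1 hq).le)

theorem tsum_xiCoeff_ne_top (hdata : IsSession μ f g₀ p q M X B) (hg : Measurable g₀)
    (hg1 : ∫⁻ x, g₀ x = 1) (hq : q ∈ Set.Ioo (0 : ℝ) 1) {r : ℕ} (hr : 2 ≤ r) :
    ∑' k, xiCoeff p q r (k + 1) ≠ ∞ := by
  obtain ⟨s, rfl⟩ : ∃ s, r = s + 2 := ⟨r - 2, by omega⟩
  exact ENNReal.ne_top_of_tsum_ne_top (tsum_tsum_xiCoeff_ne_top hdata hg hg1 hq) s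

end Mass

/-- Bounded and unbounded flow sizes share this argument; they differ only in `G`, `w` and `N`. The
quotient term is harmless: multiplied by the true density it is at most `w` plus a partial sum for
`h`, whose integral is finite. -/
theorem tendstoInMeasure_sampledSymbol {Ω P : Type*} [MeasurableSpace Ω] [MetricSpace P]
    {μ : Measure Ω} [IsProbabilityMeasure μ] {g : P → ℝ → ℝ≥0∞} {K : Set P} {θ₀ : P}
    (hK : IsCompact K) (hθ₀ : θ₀ ∈ K) (hreg : IsRegular g K) (hid : Identifiable g K)
    {h : ℝ → ℝ≥0∞} (hh : Measurable h) (hhi : ∫⁻ x, h x ≠ ∞)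
    (hgh : ∀ᵐ x : ℝ, ∀ θ ∈ K, g θ x ≤ h x)
    {f : ℝ → ℝ≥0∞} {p : PMF ℕ} (hp : ∃ m, 1 ≤ m ∧ p m ≠ 0) {q : ℝ}
    (hq : q ∈ Set.Ioo (0 : ℝ) 1) (hunif : XiConvergesUniformly p q g K)
    {M : ℕ → Ω → ℕ} {X : ℕ → ℕ → Ω → ℝ} {B : ℕ → ℕ → Ω → Bool}
    (hdata : IsSession μ f (g θ₀) p q M X B) {N : ℕ} {G : ℝ × ℕ → ℝ≥0∞} (hGm : Measurable G)
    (hG : ∫⁻ ω, G (sampledSymbol (fun j => X 0 j ω)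
      (retained (fun j => B 0 j ω) (M 0 ω))).2 ∂μ ≠ ∞)
    {w : ℝ × ℕ → ℝ≥0∞} (hwm : Measurable w) (hw : ∫⁻ e, w e ∂(layered sampledBase) ≠ ∞)
    (hbound : ∀ r, 2 ≤ r → ∀ᵐ x : ℝ, ∀ θ ∈ K, xi p q (g θ₀) r x ≠ 0 →
      ENNReal.ofReal (Real.log (1 + (xi p q (g θ) r x / xi p q (g θ₀) r x).toReal))
        ≤ G (x, r) + (w (x, r) + xiPartial p q h r N x) / xi p q (g θ₀) r x)
    {θhat : ℕ → Ω → P}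
    (hhat : IsMLE μ (fun θ => sampledLikelihood p q (g θ))
      (fun i ω => sampledSymbol (fun j => X i j ω) (retained (fun j => B i j ω) (M i ω))) K θhat) :
    TendstoInMeasure μ θhat atTop fun _ => θ₀ := by
  have hg0 := hreg.measurable θ₀ hθ₀
  have hC : 1 ≤ ∫⁻ x, h x := by
    rw [← hreg.lintegral_eq_one θ₀ hθ₀]
    exact lintegral_mono_ae (hgh.mono fun x hx => hx θ₀ hθ₀)
  set L : P → ℝ × ℕ → ℝ≥0∞ := fun θ e => sampledLikelihood p q (g θ) (0, e) with hLdef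
  have hL : ∀ θ ∈ K, Measurable (L θ) := fun θ hθ =>
    measurable_sampledLikelihood p q (hreg.measurable θ hθ)
  have hlt : ∀ θ r, r < 2 → ∀ x, L θ (x, r) = ∑' m : ℕ, p m * ENNReal.ofReal (tau q m r) :=
    fun θ r hr x => by simp only [hLdef, sampledLikelihood, if_pos hr]
  have hge : ∀ θ r, 2 ≤ r → ∀ x, L θ (x, r) = xi p q (g θ) r x :=
    fun θ r hr x => xi_eq_sampledLikelihood (g θ) hr x
  have hg1 := hreg.lintegral_eq_one θ₀ hθ₀
  have hmass0 : ∫⁻ e, L θ₀ e ∂(layered sampledBase) = 1 :=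
    lintegral_sampledLikelihood_eq_one hdata hg0 hq
  have hmass : ∀ θ ∈ K, ∫⁻ e, L θ e ∂(layered sampledBase) ≤ 1 := fun θ hθ => by
    rw [← hmass0, hLdef]
    simp only
    rw [lintegral_sampledLikelihood (hreg.measurable θ hθ) (hreg.lintegral_eq_one θ hθ),
      lintegral_sampledLikelihood hg0 (hreg.lintegral_eq_one θ₀ hθ₀)]
  have hsum := tsum_sampled_mass hdata hg0 hg1 hq
  have hsum0 : ∀ r < 2, ∑' m : ℕ, p m * ENNReal.ofReal (tau q m r) ≠ ∞ := by
    intro r hr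
    refine ne_top_of_le_ne_top ENNReal.one_ne_top (le_trans ?_ hsum.le)
    interval_cases r
    · exact le_self_add
    · exact le_self_add.trans le_add_self
  have hsum2 := tsum_tsum_xiCoeff_ne_top hdata hg0 hg1 hq
  have hsumr : ∀ r, 2 ≤ r → ∑' k, xiCoeff p q r (k + 1) ≠ ∞ := fun r hr =>
    tsum_xiCoeff_ne_top hdata hg0 hg1 hq hr
  have hae := fun r hr => ae_xi_regular hreg hh hhi hgh hunif hr
    (ENNReal.ne_top_of_tsum_ne_top (hsumr r hr))
  have hfin : ∀ᵐ e ∂(layered sampledBase), ∀ θ ∈ K, L θ e < ∞ := by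
    refine ae_sampledBase_of_layered (fun r hr θ hθ => ?_) fun r hr => ?_
    · rw [hlt θ r hr]
      exact (hsum0 r hr).lt_top
    · filter_upwards [hae r hr] with x hx θ hθ
      rw [hge θ r hr]
      exact (hx.1 θ hθ).lt_top
  have hA : Measurable fun e : ℝ × ℕ => if e.2 < 2 then 0 else xiPartial p q h e.2 N e.1 := by
    refine measurable_from_prod_countable_left fun r => ?_
    have := measurable_xiPartial (p := p) (q := q) hh r N
    dsimp only
    split_ifs <;> fun_prop
  have hAi : ∫⁻ e : ℝ × ℕ, (if e.2 < 2 then 0 else xiPartial p q h e.2 N e.1)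
      ∂(layered sampledBase) ≠ ∞ := by
    rw [lintegral_layered_sampledBase hA]
    simp only [Nat.ofNat_pos, if_true, Nat.one_lt_ofNat, zero_add,
      if_neg (not_lt.2 (Nat.le_add_left 2 _))]
    refine ne_top_of_le_ne_top ?_ (ENNReal.tsum_le_tsum fun r => lintegral_xiPartial_le hh hC _ N)
    rw [ENNReal.tsum_mul_left]
    exact ENNReal.mul_ne_top (ENNReal.pow_ne_top hhi) hsum2
  set A : ℝ × ℕ → ℝ≥0∞ := fun e => if e.2 < 2 then 0 else xiPartial p q h e.2 N e.1 with hAdef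
  -- The leading `1` takes care of the layers `r < 2`, where the likelihood does not involve `θ` and
  -- the ratio is at most `1`.
  refine tendstoInMeasure_of_likelihood (ρ := layered sampledBase) (L := L)
    (G := fun e => 1 + (G e + (w e + A e) / L θ₀ e)) hK hθ₀ hL hmass hfin ?_ ?_ ?_ ?_ ?_
    (fun i => (measurable_sampledSymbol_session hdata i).snd) (map_sampledSymbol hdata hg0 hq) ?_ ?_
  · refine ae_sampledBase_of_layered (fun r hr θ hθ => ?_) fun r hr => ?_
    · rw [hlt θ r hr, hlt θ₀ r hr]
    · filter_upwards [hae r hr] with x hx θ hθ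
      rw [hge θ r hr, hge θ₀ r hr]
      exact hx.2.2.2.1 θ hθ θ₀ hθ₀
  · refine ae_sampledBase_of_layered (fun r hr => ?_) fun r hr => ?_
    · simp only [hlt _ r hr]
      exact continuousOn_const
    · filter_upwards [hae r hr] with x hx
      simp only [hge _ r hr]
      exact hx.2.2.2.2.1
  · intro θ hθ heq
    refine hid θ hθ θ₀ hθ₀ (ae_eq_of_xi_ae_eq (hreg.measurable θ hθ) hg0
      (hreg.lintegral_eq_one θ hθ) (hreg.lintegral_eq_one θ₀ hθ₀)
      (hreg.eq_zero_of_neg θ hθ) (hreg.eq_zero_of_neg θ₀ hθ₀)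
      (exists_xiCoeff_two_ne_zero hp hq) (hsumr 2 le_rfl) ?_)
    have := ae_layered_iff.1 heq 2
    simp only [sampledBase, lt_irrefl, if_false, hge _ 2 le_rfl] at this
    exact this
  · have hL0 := hL θ₀ hθ₀
    have hdiv : ∫⁻ e, (w e + A e) / L θ₀ e ∂((layered sampledBase).withDensity (L θ₀)) ≠ ∞ := by
      have hm : Measurable fun e => (w e + A e) / L θ₀ e := (hwm.add hA).div hL0
      rw [lintegral_withDensity_eq_lintegral_mul _ hL0 hm]
      refine ne_top_of_le_ne_top (b := ∫⁻ e, (w e + A e) ∂(layered sampledBase)) ?_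
        (lintegral_mono fun e => ENNReal.mul_div_le)
      rw [lintegral_add_left hwm]
      exact ENNReal.add_ne_top.2 ⟨hw, hAi⟩
    have hG' : ∫⁻ e, G e ∂((layered sampledBase).withDensity (L θ₀)) ≠ ∞ := by
      rwa [← lintegral_sampledSymbol hdata hg0 hq 0 hGm]
    have h1 : ∫⁻ _, 1 ∂((layered sampledBase).withDensity (L θ₀)) ≠ ∞ := by
      rw [lintegral_one, withDensity_apply _ MeasurableSet.univ, Measure.restrict_univ, hmass0]
      exact ENNReal.one_ne_top
    rw [lintegral_add_left measurable_const, lintegral_add_left hGm]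
    exact ENNReal.add_ne_top.2 ⟨h1, ENNReal.add_ne_top.2 ⟨hG', hdiv⟩⟩
  · refine ae_sampledBase_of_layered (fun r hr h0 θ hθ => ?_) fun r hr => ?_
    · refine le_trans ?_ le_self_add
      rw [hlt θ r hr, hlt θ₀ r hr, ENNReal.ofReal_le_one]
      have h1 := ENNReal.toReal_mono ENNReal.one_ne_top
        (ENNReal.div_self_le_one (a := ∑' m : ℕ, p m * ENNReal.ofReal (tau q m r)))
      rw [ENNReal.toReal_one] at h1
      have h2 := Real.log_le_sub_one_of_pos (x := 1 + ((∑' m : ℕ, p m * ENNReal.ofReal (tau q m r)) /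
        ∑' m : ℕ, p m * ENNReal.ofReal (tau q m r)).toReal) (by positivity)
      linarith
    · filter_upwards [hbound r hr] with x hx h0 θ hθ
      rw [hge θ₀ r hr] at h0 ⊢
      rw [hge θ r hr]
      refine (hx θ hθ h0).trans (le_trans (le_of_eq ?_) le_add_self)
      simp only [hAdef, if_neg (not_lt.2 hr)]
  · intro i j hij
    have hm : Measurable fun z : ℕ × (ℕ → ℝ) × (ℕ → Bool) =>
        (sampledSymbol z.2.1 (retained z.2.2 z.1)).2 := measurable_sampledSymbol_retained.snd
    exact (hdata.indep_flow.indepFun hij).comp hm hm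
  · intro n
    filter_upwards [hhat n] with ω h3
    have hs := sum_log_le_sum_log_of_isMaxOn hθ₀ h3.2
    have hLs : ∀ θ s, sampledLikelihood p q (g θ) s = L θ s.2 := fun _ _ => rfl
    simp only [hLs] at hs
    exact ⟨h3.1, hs⟩

/-! ### Moments of the sampled symbol -/

/-- From `1 + ∑ x j ≤ ∏ (1 + x j)`. It reduces the logarithmic moment of a duration to that of
single inter-renewal times. -/
theorem log_one_add_sum_le {ι : Type*} (s : Finset ι) {x : ι → ℝ} (hx : ∀ j ∈ s, 0 ≤ x j) :
    Real.log (1 + ∑ j ∈ s, x j) ≤ ∑ j ∈ s, Real.log (1 + x j) := by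
  classical
  induction s using Finset.induction_on with
  | empty => simp
  | insert a s ha ih =>
    rw [Finset.sum_insert ha, Finset.sum_insert ha]
    have h1 : 0 ≤ x a := hx a (Finset.mem_insert_self a s)
    have hs : ∀ j ∈ s, 0 ≤ x j := fun j hj => hx j (Finset.mem_insert_of_mem hj)
    have h2 : 0 ≤ ∑ j ∈ s, x j := Finset.sum_nonneg hs
    have h3 : Real.log (1 + (x a + ∑ j ∈ s, x j)) ≤ Real.log ((1 + x a) * (1 + ∑ j ∈ s, x j)) :=
      Real.log_le_log (by linarith) (by nlinarith)
    rw [Real.log_mul (by linarith) (by linarith)] at h3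
    linarith [ih hs]

theorem sampledSymbol_le {x : ℕ → ℝ} (hx : ∀ j, 1 ≤ j → 0 ≤ x j) {m : ℕ} {R : Finset ℕ}
    (hR : R ⊆ Finset.range (m + 1)) :
    ((sampledSymbol x R).2.2 : ℝ≥0∞) + ENNReal.ofReal (Real.log (1 + (sampledSymbol x R).2.1))
      ≤ m + 1 + ∑ j ∈ Finset.Icc 1 m, ENNReal.ofReal (Real.log (1 + x j)) := by
  by_cases hne : R.Nonempty
  · simp only [sampledSymbol, dif_pos hne]
    have hlog : ∀ j ∈ Finset.Icc 1 m, 0 ≤ Real.log (1 + x j) := fun j hj =>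
      Real.log_nonneg (by linarith [hx j (Finset.mem_Icc.1 hj).1])
    have hsub : Finset.Ioc (R.min' hne) (R.max' hne) ⊆ Finset.Icc 1 m := by
      intro j hj
      have := Finset.mem_range.1 (hR (R.max'_mem hne))
      rw [Finset.mem_Ioc] at hj
      rw [Finset.mem_Icc]
      omega
    refine add_le_add ?_ ?_
    · have := Finset.card_le_card hR
      rw [Finset.card_range] at this
      exact_mod_cast this
    · rw [← ENNReal.ofReal_sum_of_nonneg hlog]
      refine ENNReal.ofReal_le_ofReal ?_
      refine (log_one_add_sum_le _ fun j hj => hx j (Finset.mem_Icc.1 (hsub hj)).1).trans ?_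
      exact Finset.sum_le_sum_of_subset_of_nonneg hsub fun j hj _ => hlog j hj
  · simp [sampledSymbol, hne]

theorem lintegral_sampledSymbol_moments {Ω : Type*} [MeasurableSpace Ω] {μ : Measure Ω}
    [IsProbabilityMeasure μ] {f g₀ : ℝ → ℝ≥0∞} (hg : Measurable g₀) (hn : ∀ x < 0, g₀ x = 0)
    {p : PMF ℕ} {q : ℝ} {M : ℕ → Ω → ℕ} {X : ℕ → ℕ → Ω → ℝ} {B : ℕ → ℕ → Ω → Bool}
    (hdata : IsSession μ f g₀ p q M X B) (hmean : ∑' m : ℕ, (m : ℝ≥0∞) * p m ≠ ∞)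
    (hlog : ∫⁻ x, ENNReal.ofReal (Real.log (1 + x)) * g₀ x ≠ ∞) (i : ℕ) :
    ∫⁻ ω, ((sampledSymbol (fun j => X i j ω) (retained (fun j => B i j ω) (M i ω))).2.2 : ℝ≥0∞)
      + ENNReal.ofReal (Real.log (1 + (sampledSymbol (fun j => X i j ω)
        (retained (fun j => B i j ω) (M i ω))).2.1)) ∂μ ≠ ∞ := by
  have hXm := hdata.measurable_time i
  have hpos : ∀ᵐ ω ∂μ, ∀ j, 1 ≤ j → 0 ≤ X i j ω := by
    refine ae_all_iff.2 fun j => ?_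
    by_cases hj : 1 ≤ j
    · have : ∀ᵐ ω ∂μ, 0 ≤ X i j ω := by
        refine ae_of_ae_map (p := fun x : ℝ => 0 ≤ x) (hXm j).aemeasurable ?_
        rw [(hdata.law_time i j hj).map_eq, ae_withDensity_iff hg]
        exact .of_forall fun x hx => not_lt.1 fun h => hx (hn x h)
      exact this.mono fun ω h _ => h
    · exact .of_forall fun ω h => absurd h hj
  refine ne_top_of_le_ne_top ?_ (lintegral_mono_ae (hpos.mono fun ω hω =>
    sampledSymbol_le (R := retained (fun j => B i j ω) (M i ω)) hω (Finset.filter_subset _ _)))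
  have hlm : Measurable fun x : ℝ => ENNReal.ofReal (Real.log (1 + x)) :=
    (measurable_id.const_add 1).log.ennreal_ofReal
  have hlmX : ∀ j, Measurable fun ω => ENNReal.ofReal (Real.log (1 + X i j ω)) := fun j =>
    hlm.comp (hXm j)
  have hlmx : ∀ j, Measurable fun x : ℕ → ℝ => ENNReal.ofReal (Real.log (1 + x j)) := fun j =>
    hlm.comp (measurable_pi_apply j)
  rw [lintegral_indepFun_countable (Φ := fun (m : ℕ) (x : ℕ → ℝ) => (m : ℝ≥0∞) + 1 +
      ∑ j ∈ Finset.Icc 1 m, ENNReal.ofReal (Real.log (1 + x j))) (hdata.measurable_size i)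
    (measurable_pi_lambda _ hXm) ((hdata.indep_size i).comp measurable_id measurable_fst)
    (fun m => by fun_prop)]
  have hint : ∀ m : ℕ, ∫⁻ ω, ((m : ℝ≥0∞) + 1 +
      ∑ j ∈ Finset.Icc 1 m, ENNReal.ofReal (Real.log (1 + X i j ω))) ∂μ
      = m + 1 + m * ∫⁻ x, ENNReal.ofReal (Real.log (1 + x)) * g₀ x := by
    intro m
    rw [lintegral_add_left measurable_const, lintegral_const, measure_univ, mul_one,
      lintegral_finsetSum _ fun j _ => hlmX j,
      Finset.sum_congr rfl (g := fun _ => ∫⁻ x, ENNReal.ofReal (Real.log (1 + x)) * g₀ x)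
        fun j hj => ?_, Finset.sum_const, Nat.card_Icc, nsmul_eq_mul, Nat.add_sub_cancel]
    rw [← lintegral_map (f := fun x : ℝ => ENNReal.ofReal (Real.log (1 + x))) hlm (hXm j),
      (hdata.law_time i j (Finset.mem_Icc.1 hj).1).map_eq,
      lintegral_withDensity_eq_lintegral_mul _ hg hlm]
    exact lintegral_congr fun x => mul_comm _ _
  simp only [hint, measure_size_eq hdata]
  set c := ∫⁻ x, ENNReal.ofReal (Real.log (1 + x)) * g₀ x with hc
  have hsplit : ∀ m : ℕ, p m * ((m : ℝ≥0∞) + 1 + m * c) = p m + (1 + c) * (m * p m) :=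
    fun m => by ring
  simp only [hsplit]
  rw [ENNReal.tsum_add, p.tsum_coe, ENNReal.tsum_mul_left]
  exact ENNReal.add_ne_top.2 ⟨ENNReal.one_ne_top,
    ENNReal.mul_ne_top (ENNReal.add_ne_top.2 ⟨ENNReal.one_ne_top, hlog⟩) hmean⟩

theorem ofReal_log_one_add_toReal_le_self (a : ℝ≥0∞) :
    ENNReal.ofReal (Real.log (1 + a.toReal)) ≤ a := by
  refine (ENNReal.ofReal_le_ofReal ?_).trans ENNReal.ofReal_toReal_le
  have ha := a.toReal_nonneg
  linarith [Real.log_le_sub_one_of_pos (x := 1 + a.toReal) (by linarith)]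

/-- Factor `1 + a ≤ (1 + A / l) (1 + 1 / l)` and use the scale `t` on the second factor only. The
remainder `1` of the series thus becomes `t⁻¹`, which can be integrable over the base measure, at
the price of `log (1 + t)`. -/
theorem ofReal_log_one_add_le_of_le_add_one {a A l : ℝ≥0∞} (hl : l ≠ 0) (hA : A ≠ ∞)
    (ha : a ≤ (A + 1) / l) {t : ℝ} (ht : 0 < t) :
    ENNReal.ofReal (Real.log (1 + a.toReal))
      ≤ ENNReal.ofReal (Real.log (1 + t)) + (ENNReal.ofReal t⁻¹ + A) / l := by
  have hAl : A / l ≠ ∞ := ENNReal.div_ne_top hA hl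
  have h1l : 1 / l ≠ ∞ := ENNReal.div_ne_top ENNReal.one_ne_top hl
  rw [ENNReal.add_div] at ha
  have hα := (A / l).toReal_nonneg
  have hβ := (1 / l).toReal_nonneg
  have hy : a.toReal ≤ (A / l).toReal + (1 / l).toReal := by
    rw [← ENNReal.toReal_add hAl h1l]
    exact ENNReal.toReal_mono (ENNReal.add_ne_top.2 ⟨hAl, h1l⟩) ha
  have ha0 := a.toReal_nonneg
  have hlog : Real.log (1 + a.toReal) ≤
      Real.log (1 + t) + (t⁻¹ * (1 / l).toReal + (A / l).toReal) := by
    have h1 : Real.log (1 + a.toReal) ≤ Real.log ((1 + (A / l).toReal) * (1 + (1 / l).toReal)) :=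
      Real.log_le_log (by linarith) (by nlinarith [mul_nonneg hα hβ])
    rw [Real.log_mul (by linarith) (by linarith)] at h1
    have h2 := Real.log_le_sub_one_of_pos (x := 1 + (A / l).toReal) (by linarith)
    have h3 := log_one_add_le_add_div hβ ht
    rw [div_eq_inv_mul] at h3
    linarith
  refine (ENNReal.ofReal_le_ofReal hlog).trans (ENNReal.ofReal_add_le.trans ?_)
  gcongr
  refine ENNReal.ofReal_add_le.trans ?_
  rw [ENNReal.ofReal_mul (inv_nonneg.2 ht.le), ENNReal.ofReal_toReal hAl, ENNReal.ofReal_toReal h1l,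
    ENNReal.add_div, mul_one_div]

/-- The weight `(1 + r) ^ 2 * (1 + x ^ 2)` grows fast enough for its reciprocal to be summable in
`r` and integrable in `x`, yet its logarithm is controlled by `r` and `log (1 + x)`, both of finite
mean. -/
theorem log_one_add_weight_le (r : ℕ) {x : ℝ} (hx : 0 < x) :
    Real.log (1 + (1 + (r : ℝ)) ^ 2 * (1 + x ^ 2)) ≤ 1 + 2 * (r + Real.log (1 + x)) := by
  have hr : (0 : ℝ) ≤ r := Nat.cast_nonneg r
  have h1 := log_one_add_le_one_add (t := (1 + (r : ℝ)) ^ 2 * (1 + x ^ 2))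
    (by nlinarith [sq_nonneg x, mul_nonneg hr (sq_nonneg x)])
  rw [Real.log_mul (by positivity) (by positivity), Real.log_pow] at h1
  have h2 := Real.log_le_sub_one_of_pos (x := 1 + (r : ℝ)) (by positivity)
  have h3 : Real.log (1 + x ^ 2) ≤ Real.log ((1 + x) ^ 2) :=
    Real.log_le_log (by positivity) (by nlinarith)
  rw [Real.log_pow] at h3
  push_cast at h1 h3
  linarith

theorem measurable_weight : Measurable fun e : ℝ × ℕ =>
    ENNReal.ofReal ((1 + (e.2 : ℝ)) ^ 2 * (1 + e.1 ^ 2))⁻¹ := by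
  refine measurable_from_prod_countable_left fun r => ?_
  dsimp only
  fun_prop

theorem lintegral_weight_ne_top : ∫⁻ e : ℝ × ℕ,
    ENNReal.ofReal ((1 + (e.2 : ℝ)) ^ 2 * (1 + e.1 ^ 2))⁻¹ ∂(layered sampledBase) ≠ ∞ := by
  rw [lintegral_layered_sampledBase measurable_weight]
  refine ENNReal.add_ne_top.2 ⟨ENNReal.ofReal_ne_top, ENNReal.add_ne_top.2
    ⟨ENNReal.ofReal_ne_top, ?_⟩⟩
  have hterm : ∀ r : ℕ, ∫⁻ x : ℝ, ENNReal.ofReal ((1 + ((r + 2 : ℕ) : ℝ)) ^ 2 * (1 + x ^ 2))⁻¹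
      = ENNReal.ofReal (((r + 3 : ℕ) : ℝ) ^ 2)⁻¹ * ∫⁻ x : ℝ, ENNReal.ofReal (1 + x ^ 2)⁻¹ := by
    intro r
    rw [← lintegral_const_mul _ (by fun_prop)]
    refine lintegral_congr fun x => ?_
    rw [mul_inv, ENNReal.ofReal_mul (by positivity)]
    congr 4
    push_cast
    ring
  simp only [hterm]
  rw [ENNReal.tsum_mul_right]
  refine ENNReal.mul_ne_top ?_ ?_
  · have : Summable fun r : ℕ => (((r + 3 : ℕ) : ℝ) ^ 2)⁻¹ :=
      (summable_nat_add_iff 3).2 (Real.summable_nat_pow_inv.2 one_lt_two)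
    exact this.tsum_ofReal_ne_top
  · have h := integrable_inv_one_add_sq.hasFiniteIntegral
    rw [hasFiniteIntegral_iff_ofReal (.of_forall fun x => by positivity)] at h
    exact h.ne

theorem xi_le_xiPartial_add_one {P : Type*} {p : PMF ℕ} {q : ℝ} {g : P → ℝ → ℝ≥0∞} {K : Set P}
    (hunif : XiConvergesUniformly p q g K) : ∃ N, ∀ r, 2 ≤ r → ∀ x > 0, ∀ θ ∈ K,
      xi p q (g θ) r x ≠ ∞ → xi p q (g θ) r x ≤ xiPartial p q (g θ) r N x + 1 := by
  obtain ⟨N, hN⟩ := (Metric.tendstoUniformlyOn_iff.1 hunif 1 one_pos).exists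
  refine ⟨N, fun r hr x hx θ hθ hfin => ?_⟩
  have h1 := hN (r, x, θ) ⟨hr, hx, hθ⟩
  have hfinN := ne_top_of_le_ne_top hfin (xiPartial_le_xi (p := p) (q := q) (g θ) r N x)
  rw [← ENNReal.toReal_le_toReal hfin (ENNReal.add_ne_top.2 ⟨hfinN, ENNReal.one_ne_top⟩),
    ENNReal.toReal_add hfinN ENNReal.one_ne_top, ENNReal.toReal_one]
  rw [Real.dist_eq] at h1
  linarith [le_abs_self ((xi p q (g θ) r x).toReal - (xiPartial p q (g θ) r N x).toReal)]

end NetFlow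
-- Consistency of both estimators
theorem mainTheorem1 {Ω P : Type*} [MeasurableSpace Ω] [MetricSpace P]
    (μ : Measure Ω) [IsProbabilityMeasure μ]
    -- the inter-renewal model, the true parameter, and a compact neighbourhood of it
    (g : P → ℝ → ℝ≥0∞) (Θ K : Set P) (θ₀ : P)
    (hθ₀ : θ₀ ∈ interior Θ) (hK : IsCompact K) (hKΘ : K ⊆ Θ) (hKθ₀ : K ∈ 𝓝 θ₀)
    (hreg : NetFlow.IsRegular g Θ) (hid : NetFlow.Identifiable g K)
    -- the first inter-renewal density, the flow size distribution, the retention probability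
    (f : ℝ → ℝ≥0∞) (hf : Measurable f)
    (p : PMF ℕ) (hp : ∃ m, 1 ≤ m ∧ p m ≠ 0)
    (q : ℝ) (hq : q ∈ Set.Ioo (0 : ℝ) 1)
    -- conditions needed only when the flow sizes are unbounded
    (hunb : (∀ b : ℕ, ∃ m, b < m ∧ p m ≠ 0) →
      NetFlow.XiConvergesUniformly p q g K ∧
      ∑' m : ℕ, (m : ℝ≥0∞) * p m ≠ ∞ ∧
      ∫⁻ x, ENNReal.ofReal (Real.log (1 + x)) * g θ₀ x ≠ ∞)
    -- the data and the two estimators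
    (M : ℕ → Ω → ℕ) (X : ℕ → ℕ → Ω → ℝ) (B : ℕ → ℕ → Ω → Bool)
    (hdata : NetFlow.IsSession μ f (g θ₀) p q M X B)
    (θS θT : ℕ → Ω → P)
    (hθS : NetFlow.IsMLE μ (fun θ => NetFlow.likelihood f p (g θ))
      (fun i ω => NetFlow.symbol (fun j => X i j ω) (M i ω)) K θS)
    (hθT : NetFlow.IsMLE μ (fun θ => NetFlow.sampledLikelihood p q (g θ))
      (fun i ω => NetFlow.sampledSymbol (fun j => X i j ω)
        (NetFlow.retained (fun j => B i j ω) (M i ω))) K θT) :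
    TendstoInMeasure μ θS atTop (fun _ => θ₀) ∧ TendstoInMeasure μ θT atTop (fun _ => θ₀) := by
  have hθK : θ₀ ∈ K := mem_of_mem_nhds hKθ₀
  have hregK := hreg.mono hKΘ
  have hmean : ∑' m : ℕ, (m : ℝ≥0∞) * p m ≠ ∞ := by
    by_cases hb : ∀ b : ℕ, ∃ m, b < m ∧ p m ≠ 0
    · exact (hunb hb).2.1
    · exact NetFlow.tsum_mul_ne_top_of_bounded hb
  refine ⟨NetFlow.tendstoInMeasure_symbol hK hθK hregK hid hf hp hmean hdata hθS, ?_⟩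
  obtain ⟨h, hh, hhi, hgh⟩ := hregK.exists_dominating hK
  have hcoef : ∀ r, 2 ≤ r → ∀ k, NetFlow.xiCoeff p q r (k + 1) ≠ ∞ := fun r hr =>
    ENNReal.ne_top_of_tsum_ne_top (NetFlow.tsum_xiCoeff_ne_top hdata (hregK.measurable θ₀ hθK)
      (hregK.lintegral_eq_one θ₀ hθK) hq hr)
  by_cases hb : ∀ b : ℕ, ∃ m, b < m ∧ p m ≠ 0
  · obtain ⟨hunif, -, hlog⟩ := hunb hb
    obtain ⟨N, hN⟩ := NetFlow.xi_le_xiPartial_add_one hunif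
    have hlm : Measurable fun x : ℝ => ENNReal.ofReal (Real.log (1 + x)) :=
      (measurable_id.const_add 1).log.ennreal_ofReal
    have hGm : Measurable fun e : ℝ × ℕ =>
        1 + 2 * ((e.2 : ℝ≥0∞) + ENNReal.ofReal (Real.log (1 + e.1))) :=
      measurable_from_prod_countable_left fun r => by dsimp only; fun_prop
    refine NetFlow.tendstoInMeasure_sampledSymbol hK hθK hregK hid hh hhi hgh hp hq hunif hdata
      hGm ?_ NetFlow.measurable_weight NetFlow.lintegral_weight_ne_top (N := N) ?_ hθT
    · have hmom := NetFlow.lintegral_sampledSymbol_moments (hregK.measurable θ₀ hθK)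
        (hregK.eq_zero_of_neg θ₀ hθK) hdata hmean hlog 0
      rw [lintegral_add_left measurable_const, lintegral_const_mul' _ _ ENNReal.ofNat_ne_top]
      exact ENNReal.add_ne_top.2 ⟨by simp, ENNReal.mul_ne_top ENNReal.ofNat_ne_top hmom⟩
    · intro r hr
      filter_upwards [NetFlow.ae_xi_regular hregK hh hhi hgh hunif hr (hcoef r hr)]
        with x hx θ hθ h0
      -- The true likelihood is nonzero here, which rules out the nonpositive durations not covered
      -- by uniform convergence.
      have hx0 : 0 < x := hx.2.2.2.2.2.resolve_right fun H => h0 (H θ₀ hθK)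
      refine (NetFlow.ofReal_log_one_add_le_of_le_add_one h0 (hx.2.2.1 N) (ENNReal.div_le_div_right
        ((hN r hr x hx0 θ hθ (hx.1 θ hθ)).trans (by gcongr; exact hx.2.1 θ hθ N)) _)
        (t := (1 + (r : ℝ)) ^ 2 * (1 + x ^ 2)) (by positivity)).trans ?_
      gcongr
      refine (ENNReal.ofReal_le_ofReal (NetFlow.log_one_add_weight_le r hx0)).trans ?_
      refine ENNReal.ofReal_add_le.trans ?_
      rw [ENNReal.ofReal_one, ENNReal.ofReal_mul zero_le_two, ENNReal.ofReal_ofNat]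
      gcongr
      exact ENNReal.ofReal_add_le.trans_eq (by rw [ENNReal.ofReal_natCast])
  · push Not at hb
    obtain ⟨b, hb⟩ := hb
    have hunif := NetFlow.xiConvergesUniformly_of_bounded (q := q) hb g K
    -- With sizes bounded by `b`, the series equals its partial sum at `b`, so there is no remainder
    -- and `log (1 + y) ≤ y` suffices.
    refine NetFlow.tendstoInMeasure_sampledSymbol hK hθK hregK hid hh hhi hgh hp hq hunif hdata
      (G := 0) measurable_zero (by simp) (w := 0) measurable_zero (by simp) (N := b) ?_ hθT
    intro r hr
    filter_upwards [NetFlow.ae_xi_regular hregK hh hhi hgh hunif hr (hcoef r hr)] with x hx θ hθ h0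
    refine (NetFlow.ofReal_log_one_add_toReal_le_self _).trans ?_
    simp only [Pi.zero_apply, zero_add]
    rw [NetFlow.xi_eq_xiPartial_of_bounded hb (g θ) r le_rfl]
    exact ENNReal.div_le_div_right (hx.2.1 θ hθ b) _
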